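/- Let $\beta=(\beta_1,\dots,\beta_\ell)$ be a composition of $n=|\beta|$ (a finite sequence of positive integers with sum $n$) with length $\ell=\ell(\beta)\ge 3$ and all parts $\beta_i\ge 2$. Let $R_\beta$ be the connected ribbon with row lengths $\beta_1,\dots,\beta_\ell$ from top to bottom, i.e. the skew shape with these row lengths in which each two consecutive rows overlap in exactly one column. For a skew shape $A$, write the skew Schur function in the basis of Schur functions as $s_A=\sum_\nu c_A^\nu s_\nu$ ($\nu$ running over partitions) and let $[A]=\{\nu : c_A^\nu>0\}$ be its Schur support. Let $r(A)$ and $c(A)$ be the partitions formed by the row lengths and by the column lengths of $A$, and $c(A)'$ the conjugate of $c(A)$; $A$ has full Schur support if $[A]$ is the whole interval $[r(A),c(A)']$ in the dominance order on partitions of $|A|$. Let $\beta^+$ be the weakly decreasing rearrangement of $\beta$. Suppose that every 3-element submultiset $\{x\le y\le z\}$ of the multiset $\{\beta_1,\dots,\beta_\ell\}$ satisfies the strict triangle inequality $z<x+y$. Then $R_\beta$ has full Schur support, and $$[R_\beta]=\bigl[\beta^+,\,(|\beta|-\ell(\beta)+1,\ \ell(\beta)-1)\bigr],$$ the interval being taken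 in the dominance order on partitions of $|\beta|$. -/

import Mathlib

/-- The partition (as a Young diagram) whose parts are the positive entries of `w`, rearranged in
weakly decreasing order. -/
def sortedDiagram (w : List ℕ) : YoungDiagram :=
  YoungDiagram.ofRowLens (w.insertionSort (· ≥ ·)) (List.pairwise_insertionSort (· ≥ ·) w).sortedGE

/-- Dominance order: `lam ≼ mu` when both have the same size and every partial sum of the parts of
`lam` is at most the corresponding partial sum of `mu` (missing parts count as `0`). -/
def DominatedBy (lam mu : YoungDiagram) : Prop :=
  lam.card = mu.card ∧
    ∀ k : ℕ, ∑ i ∈ Finset.range k, lam.rowLen i ≤ ∑ i ∈ Finset.range k, mu.rowLen i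

/-- The interval `[lam, mu]` in the dominance order. -/
def dominanceInterval (lam mu : YoungDiagram) : Set YoungDiagram :=
  {nu | DominatedBy lam nu ∧ DominatedBy nu mu}

/-- A skew shape `outer / inner`. -/
structure SkewShape where
  outer : YoungDiagram
  inner : YoungDiagram
  inner_le : inner ≤ outer

namespace SkewShape

/-- The boxes of a skew shape: row index first, rows numbered downwards from `0`. -/
def cells (A : SkewShape) : Finset (ℕ × ℕ) := A.outer.cells \ A.inner.cells

/-- Row lengths, from top to bottom. -/
def rowLengths (A : SkewShape) : List ℕ :=
  (List.range (A.outer.colLen 0)).map fun i => A.outer.rowLen i - A.inner.rowLen i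

/-- Column lengths, from left to right. -/
def colLengths (A : SkewShape) : List ℕ :=
  (List.range (A.outer.rowLen 0)).map fun j => A.outer.colLen j - A.inner.colLen j

/-- The Schur interval `[r(A), c(A)']`, where `r(A)`, `c(A)` are the partitions formed by the row
lengths and by the column lengths of `A`, and `'` is conjugation. -/
def schurInterval (A : SkewShape) : Set YoungDiagram :=
  dominanceInterval (sortedDiagram A.rowLengths) (sortedDiagram A.colLengths).transpose

end SkewShape

/-- Semistandard tableaux of skew shape `A`, in the conventions of `SemistandardYoungTableau`:
entries are natural numbers (starting at `0`), set to `0` outside the shape. -/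
structure SkewTableau (A : SkewShape) where
  entry : ℕ → ℕ → ℕ
  row_weak : ∀ {i j₁ j₂ : ℕ}, j₁ < j₂ → (i, j₁) ∈ A.cells → (i, j₂) ∈ A.cells →
    entry i j₁ ≤ entry i j₂
  col_strict : ∀ {i₁ i₂ j : ℕ}, i₁ < i₂ → (i₁, j) ∈ A.cells → (i₂, j) ∈ A.cells →
    entry i₁ j < entry i₂ j
  zeros : ∀ {i j : ℕ}, (i, j) ∉ A.cells → entry i j = 0

/-- The content of a filling `T` of the boxes `D`: the multiplicity of each letter. -/
noncomputable def fillingContent (D : Finset (ℕ × ℕ)) (T : ℕ → ℕ → ℕ) : ℕ →₀ ℕ :=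
  ∑ c ∈ D, Finsupp.single (T c.1 c.2) 1

/-- The Schur function `s_nu = ∑_T x^T` in the variables `x₀, x₁, …`, the sum over all semistandard
tableaux of shape `nu`: the coefficient of `x^m` is the number of tableaux of content `m`. -/
noncomputable def schurFunction (nu : YoungDiagram) : MvPowerSeries ℕ ℚ := fun m =>
  (Nat.card {T : SemistandardYoungTableau nu // fillingContent nu.cells T = m} : ℚ)

namespace SkewShape

/-- The skew Schur function `s_A = ∑_T x^T`, the sum over all semistandard tableaux of shape `A`. -/
noncomputable def schurFunction (A : SkewShape) : MvPowerSeries ℕ ℚ := fun m =>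
  (Nat.card {T : SkewTableau A // fillingContent A.cells T.entry = m} : ℚ)

/-- `c` is the family of coefficients `c_A^nu` of an expansion `s_A = ∑_nu c_A^nu s_nu`. (It is
unique, as the Schur functions are linearly independent.) -/
def IsSchurExpansion (A : SkewShape) (c : YoungDiagram →₀ ℚ) : Prop :=
  A.schurFunction = c.sum fun nu a => a • _root_.schurFunction nu

/-- The Schur support `[A] = {nu : c_A^nu > 0}`. -/
def schurSupport (A : SkewShape) : Set YoungDiagram :=
  {nu | ∃ c : YoungDiagram →₀ ℚ, A.IsSchurExpansion c ∧ 0 < c nu}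

/-- `A` has full Schur support: its Schur support is the whole Schur interval. -/
def HasFullSchurSupport (A : SkewShape) : Prop :=
  A.schurSupport = A.schurInterval

end SkewShape

/-- The number of empty boxes to the left of row `i` (counted from `0`) of the connected ribbon with
row lengths `b` from top to bottom: every row below row `i` shifts it by its length minus the one
column of overlap. -/
def ribbonStart (b : List ℕ) (i : ℕ) : ℕ := ((b.drop (i + 1)).map (· - 1)).sum

theorem ribbonStart_succ {b : List ℕ} {i : ℕ} (h : i + 1 < b.length) :
    ribbonStart b i = ribbonStart b (i + 1) + (b[i + 1] - 1) := by
  unfold ribbonStart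
  rw [List.drop_eq_getElem_cons h]
  simp [add_comm]

theorem ribbonStart_anti (b : List ℕ) : Antitone (ribbonStart b) := by
  refine antitone_nat_of_succ_le fun i => ?_
  by_cases h : i + 1 < b.length
  · rw [ribbonStart_succ h]
    omega
  · have h' : b.drop (i + 1 + 1) = [] := List.drop_eq_nil_of_le (by omega)
    simp [ribbonStart, h']

theorem sortedGE_ribbonInner (b : List ℕ) :
    ((List.range b.length).map fun i => ribbonStart b i).SortedGE := by
  refine List.Pairwise.sortedGE ?_
  rw [List.pairwise_map]
  exact List.pairwise_lt_range.imp fun h => ribbonStart_anti b h.le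

theorem sortedGE_ribbonOuter (b : List ℕ) (hb : ∀ x ∈ b, 0 < x) :
    ((List.range b.length).map fun i => ribbonStart b i + b.getD i 0).SortedGE := by
  refine List.Pairwise.sortedGE ?_
  rw [List.pairwise_map]
  refine List.pairwise_lt_range.imp_of_mem ?_
  intro i j hi hj hij
  rw [List.mem_range] at hi hj
  obtain ⟨k, rfl⟩ : ∃ k, j = k + 1 := ⟨j - 1, by omega⟩
  have h1 := ribbonStart_succ hj
  have h2 : ribbonStart b k ≤ ribbonStart b i := ribbonStart_anti b (by omega)
  have h3 := hb _ (List.getElem_mem hi)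
  have h4 := hb _ (List.getElem_mem hj)
  rw [List.getD_eq_getElem _ _ hi, List.getD_eq_getElem _ _ hj]
  show ribbonStart b (k + 1) + b[k + 1] ≤ ribbonStart b i + b[i]
  omega

/-- The connected ribbon `R_b` with row lengths `b₁, …, b_ℓ` from top to bottom, consecutive rows
overlapping in exactly one column: row `i` occupies the columns
`ribbonStart b i ≤ j < ribbonStart b i + b_i`. -/
def ribbon {n : ℕ} (b : Composition n) : SkewShape where
  outer := YoungDiagram.ofRowLens _ (sortedGE_ribbonOuter b.blocks fun _ h => b.blocks_pos h)
  inner := YoungDiagram.ofRowLens _ (sortedGE_ribbonInner b.blocks)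
  inner_le := by
    intro c hc
    rw [YoungDiagram.mem_ofRowLens] at hc ⊢
    obtain ⟨h, hc⟩ := hc
    refine ⟨by simpa using h, ?_⟩
    simp only [List.getElem_map, List.getElem_range] at hc ⊢
    omega

theorem mem_ribbon_cells {n : ℕ} (b : Composition n) (i j : ℕ) :
    (i, j) ∈ (ribbon b).cells ↔ i < b.blocks.length ∧ ribbonStart b.blocks i ≤ j ∧
      j < ribbonStart b.blocks i + b.blocks.getD i 0 := by
  unfold SkewShape.cells ribbon
  rw [Finset.mem_sdiff, YoungDiagram.mem_cells, YoungDiagram.mem_cells,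
    YoungDiagram.mem_ofRowLens, YoungDiagram.mem_ofRowLens]
  simp only [List.length_map, List.length_range, List.getElem_map, List.getElem_range]
  constructor
  · rintro ⟨⟨h, h1⟩, h2⟩
    exact ⟨h, not_lt.1 fun h3 => h2 ⟨h, h3⟩, h1⟩
  · rintro ⟨h, h1, h2⟩
    exact ⟨⟨h, h2⟩, fun ⟨_, h3⟩ => absurd h3 (not_lt.2 h1)⟩

/-- All 3-submultisets `{x ≤ y ≤ z}` of the multiset `s` satisfy the strict triangle inequality. -/
def AllStrictTriangles (s : Multiset ℕ) : Prop :=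
  ∀ x y z : ℕ, x ≤ y → y ≤ z → ({x, y, z} : Multiset ℕ) ≤ s → z < x + y

/-! The coefficient of a Schur function in the expansion of a ribbon is a number of lattice words.
Reading ribbon tableaux from right to left and from top to bottom gives the words that ascend
exactly where the ribbon steps down to its next row. Replace the letters by the operators that add a
box to a row of a shape. By the Pieri rule, the Schur polynomials, as a function of the shape, form
a common eigenvector of the sums over weakly decreasing words. A product of two ribbon sums is the
sum of the two ribbon sums obtained by joining with or without an ascent, so this function is an
eigenvector of every ribbon sum (`wordSum_apply_eq_smul`). Evaluation at the empty shape gives the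
Littlewood-Richardson rule for ribbons (`isSchurExpansion_ribbonCoeff`).

Cut into one weakly decreasing piece per row, a lattice word becomes a chain of horizontal strips
whose sizes are the row lengths; an ascent at a junction says that the new strip has a box strictly
below some box of the previous one (`HasDescentChain`). Strips force the final shape to dominate the
row lengths, and every descent keeps one box off the first row. It remains to show that these two
necessary conditions suffice (`hasChains`).

The proof is an induction that removes the last strip, of size `x`, as low as possible; this
preserves dominance. There are two obstacles. The remaining first row may be too long. Then exactly
the excess is taken from it and the rest from below; what remains has an extremal first row, so it
dominates automatically and its last strip meets the first row, which yields the descent. Or the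
strip may lie inside the last row. Then the earlier chain has to end above that row, which is the
auxiliary property `HasHighChains`, proved in the same induction. The triangle inequalities enter
twice: they bound the second row, so that shortening the first row leaves a partition
(`row_one_le`), and they bound the remaining parts by the rows left in the auxiliary step.

Since all parts are at least 2, the columns of the ribbon have length 1 or 2. Hence the upper end of
the Schur interval has two rows, and being dominated by it is only a bound on the first row. -/

namespace RibbonSupport

open Finset

/-! ### Shapes as row-length functions and horizontal strips -/

/-- `la / ka` is a horizontal strip (the shapes are given by their row lengths). -/
def IsStrip (ka la : ℕ →₀ ℕ) : Prop := (∀ i, ka i ≤ la i) ∧ ∀ i, la (i + 1) ≤ ka i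

theorem IsStrip.antitone_left {ka la : ℕ →₀ ℕ} (h : IsStrip ka la) : Antitone ka :=
  antitone_nat_of_succ_le fun i => (h.1 (i + 1)).trans (h.2 i)

theorem IsStrip.antitone_right {ka la : ℕ →₀ ℕ} (h : IsStrip ka la) : Antitone la :=
  antitone_nat_of_succ_le fun i => (h.2 i).trans (h.1 i)

theorem exists_forall_ge_eq_zero (la : ℕ →₀ ℕ) : ∃ N, ∀ i, N ≤ i → la i = 0 := by
  refine ⟨la.support.sup id + 1, fun i hi => ?_⟩
  by_contra h
  have := Finset.le_sup (f := id) (Finsupp.mem_support_iff.2 h)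
  simp only [id] at this
  omega

theorem sum_range_eq_degree {la : ℕ →₀ ℕ} {N : ℕ} (h : ∀ i, N ≤ i → la i = 0) :
    ∑ i ∈ range N, la i = la.degree := by
  rw [Finsupp.degree_apply]
  symm
  refine Finset.sum_subset (fun i hi => ?_) fun i _ hi => by simpa using hi
  rw [Finsupp.mem_support_iff] at hi
  rw [Finset.mem_range]
  by_contra h'
  exact hi (h i (by omega))

theorem sum_range_mono (la : ℕ →₀ ℕ) {j k : ℕ} (h : j ≤ k) :
    ∑ i ∈ range j, la i ≤ ∑ i ∈ range k, la i :=
  Finset.sum_le_sum_of_subset (Finset.range_mono h)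

theorem sum_range_le_degree (la : ℕ →₀ ℕ) (j : ℕ) : ∑ i ∈ range j, la i ≤ la.degree := by
  obtain ⟨N, hN⟩ := exists_forall_ge_eq_zero la
  rw [← sum_range_eq_degree (N := max j N) fun i hi => hN i (by omega)]
  exact sum_range_mono la (le_max_left _ _)

theorem exists_finsupp_eq {f : ℕ → ℕ} {N : ℕ} (h : ∀ i, N ≤ i → f i = 0) :
    ∃ F : ℕ →₀ ℕ, ∀ i, F i = f i := by
  refine ⟨Finsupp.ofSupportFinite f ((Set.finite_Iio N).subset fun i hi => ?_), fun i => rfl⟩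
  by_contra h'
  exact hi (h i (by simpa using h'))

theorem sum_le_of_le {s t : Multiset ℕ} (h : s ≤ t) : s.sum ≤ t.sum := by
  obtain ⟨u, rfl⟩ := Multiset.le_iff_exists_add.1 h
  simp

/-- The last non-empty row of a non-empty shape. -/
theorem exists_last_row {la : ℕ →₀ ℕ} (h : Antitone la) (h0 : 0 < la 0) :
    ∃ M, 0 < la M ∧ ∀ i, M < i → la i = 0 := by
  classical
  have hex : ∃ N, la N = 0 := by
    obtain ⟨N, hN⟩ := exists_forall_ge_eq_zero la
    exact ⟨N, hN N le_rfl⟩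
  have h1 : Nat.find hex ≠ 0 := fun h2 => by
    have := Nat.find_spec hex
    rw [h2] at this
    omega
  refine ⟨Nat.find hex - 1, Nat.pos_of_ne_zero (Nat.find_min hex (by omega)), fun i hi => ?_⟩
  have := h (show Nat.find hex ≤ i by omega)
  have h3 := Nat.find_spec hex
  omega

theorem exists_row_between {la : ℕ →₀ ℕ} {c g : ℕ} (hg : 0 < g) (hc : g ≤ la c) :
    ∃ r, c ≤ r ∧ g ≤ la r ∧ la (r + 1) < g := by
  classical
  have hex : ∃ k, la (c + k) < g := by
    obtain ⟨N, hN⟩ := exists_forall_ge_eq_zero la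
    exact ⟨N, by rw [hN _ (by omega)]; exact hg⟩
  have h1 : Nat.find hex ≠ 0 := fun h2 => by
    have := Nat.find_spec hex
    rw [h2] at this
    simp only [add_zero] at this
    omega
  refine ⟨c + (Nat.find hex - 1), by omega, ?_, ?_⟩
  · have := Nat.find_min hex (show Nat.find hex - 1 < Nat.find hex by omega)
    omega
  · have := Nat.find_spec hex
    rwa [show c + (Nat.find hex - 1) + 1 = c + Nat.find hex by omega]

/-- Removing the lowest possible horizontal strip of size `g` from the columns of length more than
`c`: only row `r` is cut, the rows above keep their length, and the rows below move up. -/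
theorem exists_lowest_strip {la : ℕ →₀ ℕ} (h : Antitone la) {c g : ℕ} (hg : 0 < g)
    (hc : g ≤ la c) :
    ∃ mu : ℕ →₀ ℕ, IsStrip mu la ∧ (∀ i, i < c → mu i = la i) ∧
      la.degree = mu.degree + g ∧
      (∀ j, ∑ i ∈ range j, mu i = ∑ i ∈ range j, la i ∨
        ∑ i ∈ range j, mu i + g = ∑ i ∈ range (j + 1), la i) ∧
      (la (c + 1) < g → mu c + g = la c + la (c + 1)) ∧
      ∀ M, (∀ i, M < i → la i = 0) →
        mu M = 0 ∨ (∀ i, mu i + Finsupp.single M g i = la i) := by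
  obtain ⟨r, hr, h1, h2⟩ := exists_row_between hg hc
  obtain ⟨N, hN⟩ := exists_forall_ge_eq_zero la
  -- Here `r` is the last row of length at least `g`. The strip consists of the bottom boxes of the
  -- `la (r + 1)` columns that reach below row `r`, together with the last `g - la (r + 1)` boxes of
  -- row `r`.
  obtain ⟨mu, hmu⟩ := exists_finsupp_eq (N := max N (r + 1))
    (f := fun i => if i < r then la i else if i = r then la r + la (r + 1) - g else la (i + 1))
    (by
      intro i hi
      rw [if_neg (by omega), if_neg (by omega)]
      exact hN _ (by omega))
  have hlow : ∀ j, j ≤ r → ∑ i ∈ range j, mu i = ∑ i ∈ range j, la i := fun j hj =>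
    Finset.sum_congr rfl fun i hi => by
      rw [Finset.mem_range] at hi
      rw [hmu, if_pos (by omega)]
  have hhigh : ∀ j, r < j → ∑ i ∈ range j, mu i + g = ∑ i ∈ range (j + 1), la i := by
    intro j hj
    induction j, hj using Nat.le_induction with
    | base =>
      rw [Finset.sum_range_succ, Finset.sum_range_succ, Finset.sum_range_succ, hlow r le_rfl, hmu,
        if_neg (by omega), if_pos rfl]
      omega
    | succ j hj ih =>
      rw [Finset.sum_range_succ, Finset.sum_range_succ _ (j + 1), ← ih, hmu, if_neg (by omega),
        if_neg (by omega)]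
      omega
  refine ⟨mu, ⟨fun i => ?_, fun i => ?_⟩, fun i hi => ?_, ?_, fun j => ?_, fun h3 => ?_,
    fun M hM => ?_⟩
  · have := h (show i ≤ i + 1 by omega)
    rw [hmu]
    split_ifs with h3 h4
    · exact le_rfl
    · subst h4; omega
    · exact this
  · have := h (show i ≤ i + 1 by omega)
    rw [hmu]
    split_ifs with h3 h4
    · exact this
    · subst h4; omega
    · exact le_rfl
  · rw [hmu, if_pos (by omega)]
  · have h3 := hhigh (max N (r + 1)) (by omega)
    rw [sum_range_eq_degree, sum_range_eq_degree] at h3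
    · exact h3.symm
    · exact fun i hi => hN i (by omega)
    · intro i hi
      rw [hmu, if_neg (by omega), if_neg (by omega)]
      exact hN _ (by omega)
  · rcases le_or_gt j r with hj | hj
    · exact Or.inl (hlow j hj)
    · exact Or.inr (hhigh j hj)
  · have : r = c := by
      by_contra h4
      have := h (show c + 1 ≤ r by omega)
      omega
    subst this
    rw [hmu, if_neg (by omega), if_pos rfl]
    omega
  · rcases lt_trichotomy M r with h3 | h3 | h3
    · rw [hM r h3] at h1
      omega
    · subst h3
      right
      intro i
      have := hM (M + 1) (by omega)
      rw [hmu, Finsupp.single_apply]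
      rcases lt_trichotomy i M with h4 | h4 | h4
      · rw [if_pos h4, if_neg (by omega)]; rfl
      · subst h4
        rw [if_neg (by omega), if_pos rfl, if_pos rfl]
        omega
      · rw [if_neg (by omega), if_neg (by omega), if_neg (by omega), hM i h4,
          hM (i + 1) (by omega)]
        rfl
    · left
      rw [hmu, if_neg (by omega), if_neg (by omega)]
      exact hM _ (by omega)

/-! ### Chains of strips with descents -/

/-- Chains of shapes from the empty shape to `la` by horizontal strips with sizes the entries of `b`
(the last strip first) such that each strip has a box strictly below some box of the strip before;
`u` is the row of a box of the last strip. -/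
inductive HasDescentChain : List ℕ → (ℕ →₀ ℕ) → ℕ → Prop
  | single (r : ℕ) (hr : 0 < r) : HasDescentChain [r] (Finsupp.single 0 r) 0
  | cons {b : List ℕ} {ka la : ℕ →₀ ℕ} {t i r u : ℕ} (h : HasDescentChain b ka t)
      (hs : IsStrip ka la) (hd : la.degree = ka.degree + r) (hti : t < i) (hi : ka i < la i)
      (hu : ka u < la u) : HasDescentChain (r :: b) la u

theorem HasDescentChain.antitone {b : List ℕ} {la : ℕ →₀ ℕ} {u : ℕ}
    (h : HasDescentChain b la u) : Antitone la := by
  cases h with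
  | single r hr =>
    refine antitone_nat_of_succ_le fun i => ?_
    simp [Finsupp.single_apply]
  | cons h hs => exact hs.antitone_right

theorem HasDescentChain.pos {b : List ℕ} {la : ℕ →₀ ℕ} {u : ℕ} (h : HasDescentChain b la u) :
    0 < la u := by
  cases h with
  | single r hr => simpa using hr
  | cons h hs hd hti hi hu => omega

theorem HasDescentChain.degree_eq {b : List ℕ} {la : ℕ →₀ ℕ} {u : ℕ}
    (h : HasDescentChain b la u) : la.degree = b.sum := by
  induction h with
  | single r hr => simp [Finsupp.degree_single]
  | cons h hs hd hti hi hu ih => rw [hd, ih, List.sum_cons, add_comm]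

theorem add_le_degree {ka : ℕ →₀ ℕ} {i j : ℕ} (h : i ≠ j) : ka i + ka j ≤ ka.degree := by
  have h1 : ka.degree = ∑ k ∈ range (max i j + 1 + (ka.support.sup id + 1)), ka k := by
    symm
    refine sum_range_eq_degree fun k hk => ?_
    by_contra h
    have := Finset.le_sup (f := id) (Finsupp.mem_support_iff.2 h)
    simp only [id] at this
    omega
  rw [h1, ← Finset.sum_pair h]
  refine Finset.sum_le_sum_of_subset fun k hk => ?_
  simp only [Finset.mem_insert, Finset.mem_singleton] at hk
  rw [Finset.mem_range]
  omega

theorem IsStrip.exists_add {ka la : ℕ →₀ ℕ} (h : IsStrip ka la) : ∃ X, la = ka + X :=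
  ⟨la - ka, (add_tsub_cancel_of_le (show ka ≤ la from h.1)).symm⟩

/-- Each strip after the first has a box strictly below another box, hence off the first row, so it
lengthens that row by at most its size minus one. -/
theorem HasDescentChain.zero_row_le {b : List ℕ} {la : ℕ →₀ ℕ} {u : ℕ}
    (h : HasDescentChain b la u) : la 0 + b.length ≤ b.sum + 1 := by
  induction h with
  | single r hr => simp
  | @cons b ka la t i r u h hs hd hti hi hu ih =>
    obtain ⟨X, rfl⟩ := hs.exists_add
    have h1 : X 0 + X i ≤ X.degree := add_le_degree (by omega)
    rw [map_add] at hd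
    simp only [Finsupp.add_apply, List.length_cons, List.sum_cons] at *
    omega

/-- If the first row is as long as possible, every strip meets it. -/
theorem HasDescentChain.of_zero_row_eq {b : List ℕ} {la : ℕ →₀ ℕ} {u : ℕ}
    (h : HasDescentChain b la u) (h0 : la 0 + b.length = b.sum + 1) (h2 : ∀ x ∈ b, 2 ≤ x) :
    HasDescentChain b la 0 := by
  cases h with
  | single r hr => exact .single r hr
  | cons h hs hd hti hi hu =>
    refine .cons h hs hd hti hi ?_
    have := h.zero_row_le
    simp only [List.length_cons, List.sum_cons, List.mem_cons, forall_eq_or_imp] at *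
    omega

/-- A strip larger than row `M` is not contained in row `M`. -/
theorem HasDescentChain.exists_ne {q : ℕ} {b : List ℕ} {la : ℕ →₀ ℕ} {u M : ℕ}
    (h : HasDescentChain (q :: b) la u) (hM : la M < q) : ∃ v, v ≠ M ∧
      HasDescentChain (q :: b) la v := by
  cases h with
  | single r hr =>
    refine ⟨0, fun h => ?_, .single _ hr⟩
    subst h
    simp at hM
  | @cons b ka la t i r u h hs hd hti hi hu =>
    obtain ⟨X, rfl⟩ := hs.exists_add
    by_contra! hcon
    have h1 : ∀ v, v ≠ M → X v = 0 := by
      intro v hv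
      by_contra h2
      exact hcon v hv (.cons h hs hd hti hi (by simp only [Finsupp.add_apply]; omega))
    have h3 : X = Finsupp.single M (X M) := by
      ext v
      rw [Finsupp.single_apply]
      split_ifs with h4
      · rw [h4]
      · exact h1 v (Ne.symm h4)
    rw [map_add, h3, Finsupp.degree_single] at hd
    simp only [Finsupp.add_apply] at hM
    omega

/-! ### Dominance and the triangle inequalities -/

/-- The partition formed by the parts `b` is dominated by `la`. -/
def DomParts (b : Multiset ℕ) (la : ℕ →₀ ℕ) : Prop :=
  ∀ s ≤ b, s.sum ≤ ∑ i ∈ range (Multiset.card s), la i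

/-- Frees the triangle inequality from the ordering of the triple: if `z` is not the largest entry,
positivity of the other one suffices. -/
theorem lt_add_of_allStrictTriangles {b : Multiset ℕ} (h : AllStrictTriangles b) {x y z : ℕ}
    (hs : ({x, y, z} : Multiset ℕ) ≤ b) (hx : 0 < x) (hy : 0 < y) : z < x + y := by
  rcases le_or_gt z x with h1 | h1
  · omega
  rcases le_or_gt z y with h2 | h2
  · omega
  rcases le_total x y with h3 | h3
  · exact h x y z h3 h2.le hs
  · rw [show ({x, y, z} : Multiset ℕ) = {y, x, z} from Multiset.cons_swap _ _ _] at hs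
    have := h y x z h3 h1.le hs
    omega

theorem allStrictTriangles_mono {b c : Multiset ℕ} (h : AllStrictTriangles b) (hc : c ≤ b) :
    AllStrictTriangles c := fun x y z hxy hyz hs => h x y z hxy hyz (hs.trans hc)

theorem two_mul_card_le_sum {b : Multiset ℕ} (h : ∀ x ∈ b, 2 ≤ x) :
    2 * Multiset.card b ≤ b.sum := by
  have := Multiset.card_nsmul_le_sum h
  rw [smul_eq_mul] at this
  omega

/-- A shape with longest possible first row dominates. -/
theorem domParts_of_zero_row_eq {b : List ℕ} {mu : ℕ →₀ ℕ} (h : Antitone mu)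
    (hd : mu.degree = b.sum) (h0 : mu 0 + b.length = b.sum + 1) (h2 : ∀ x ∈ b, 2 ≤ x) :
    DomParts b mu := by
  intro s hs
  have hsum : s.sum ≤ b.sum := by simpa using sum_le_of_le hs
  obtain ⟨t, ht⟩ := Multiset.le_iff_exists_add.1 hs
  have h3 : 2 * Multiset.card t ≤ t.sum := by
    refine two_mul_card_le_sum fun x hx => h2 x ?_
    rw [← Multiset.mem_coe, ht]
    exact Multiset.mem_add.2 (Or.inr hx)
  have h4 : b.length = Multiset.card s + Multiset.card t := by
    rw [← Multiset.card_add, ← ht, Multiset.coe_card]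
  have h5 : b.sum = s.sum + t.sum := by
    rw [← Multiset.sum_add, ← ht, Multiset.sum_coe]
  rcases Nat.eq_zero_or_pos (Multiset.card s) with h6 | h6
  · rw [Multiset.card_eq_zero.1 h6]; simp
  obtain ⟨k, hk⟩ : ∃ k, Multiset.card s = k + 1 := ⟨Multiset.card s - 1, by omega⟩
  rw [hk]
  -- Either the first `k + 1` rows already contain the whole shape, or each of the `k` rows after
  -- the first contributes at least one box. In the second case the total is at least `b.sum - card
  -- t`, while `s.sum ≤ b.sum - 2 * card t`.
  rcases Nat.eq_zero_or_pos (mu k) with h7 | h7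
  · rw [sum_range_eq_degree fun i hi => Nat.le_zero.1 ((h (show k ≤ i by omega)).trans h7.le), hd]
    exact hsum
  · rw [Finset.sum_range_succ']
    have h8 : Finset.card (range k) • 1 ≤ ∑ i ∈ range k, mu (i + 1) :=
      Finset.card_nsmul_le_sum _ _ _ fun i hi => by
        rw [Finset.mem_range] at hi
        have := h (show i + 1 ≤ k by omega)
        omega
    rw [Finset.card_range, smul_eq_mul] at h8
    omega

theorem domParts_of_le {b : List ℕ} {mu : ℕ →₀ ℕ} (hd : mu.degree = b.sum) {M B : ℕ}
    (hM : ∀ i, M < i → mu i = 0) (hB : ∀ i, i < M → B ≤ mu i) (hb : ∀ x ∈ b, x ≤ B) :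
    DomParts b mu := by
  intro s hs
  rcases le_or_gt (Multiset.card s) M with h1 | h1
  · have h3 : s.sum ≤ Multiset.card s • B :=
      Multiset.sum_le_card_nsmul _ _ fun x hx =>
        hb x (Multiset.mem_coe.1 (Multiset.mem_of_le hs hx))
    have h4 : Finset.card (range (Multiset.card s)) • B ≤ ∑ i ∈ range (Multiset.card s), mu i :=
      Finset.card_nsmul_le_sum _ _ _ fun i hi => hB i (by rw [Finset.mem_range] at hi; omega)
    rw [Finset.card_range] at h4
    exact h3.trans h4
  · rw [sum_range_eq_degree fun i hi => hM i (by omega), hd]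
    simpa using sum_le_of_le hs

theorem DomParts.le_zero_row {q : ℕ} {b : Multiset ℕ} {la : ℕ →₀ ℕ} (h : DomParts (q ::ₘ b) la) :
    q ≤ la 0 := by
  simpa using h {q} (by simp)

/-- Under the triangle inequalities the second row is not longer than the longest possible first
row for the parts `b`. -/
theorem row_one_le {q : ℕ} {b : List ℕ} {la : ℕ →₀ ℕ} (h : Antitone la)
    (hd : la.degree = q + b.sum) (hdom : DomParts ((q :: b : List ℕ) : Multiset ℕ) la)
    (h2 : ∀ x ∈ b, 2 ≤ x) (htri : AllStrictTriangles ((q :: b : List ℕ) : Multiset ℕ))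
    (hb : b ≠ []) : la 1 + b.length ≤ b.sum + 1 := by
  have h01 : la 0 + la 1 ≤ la.degree := add_le_degree (by omega)
  have hq : q ≤ la 0 := DomParts.le_zero_row (b := b) hdom
  have h10 := h (show 0 ≤ 1 by omega)
  match b, hb with
  | [p], _ => simp at *; omega
  | x :: y :: c, _ =>
    have hx := h2 x (by simp)
    have hy := h2 y (by simp)
    -- With `q ≤ x + y - 1` and the other parts at least 2, `b.sum ≥ q + 2 * b.length - 3`. As twice
    -- the second row is at most `q + b.sum`, the bound follows up to one half, and integrality
    -- removes the half.
    have h3 : q < x + y := lt_add_of_allStrictTriangles htri (x := x) (y := y) (z := q) (by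
      rw [show ({x, y, q} : Multiset ℕ) = q ::ₘ x ::ₘ y ::ₘ 0 by
        rw [Multiset.cons_swap q, Multiset.cons_swap q]; rfl]
      exact Multiset.cons_le_cons q (Multiset.cons_le_cons x (Multiset.cons_le_cons y
        (Multiset.zero_le (c : Multiset ℕ))))) (by omega) (by omega)
    have h4 := two_mul_card_le_sum (b := (c : Multiset ℕ)) fun z hz =>
      h2 z (by simp at hz; simp [hz])
    simp only [Multiset.coe_card, Multiset.sum_coe, List.sum_cons, List.length_cons] at *
    omega

/-! ### Existence of chains -/

/-- Every shape allowed by dominance and by the length of its first row has a chain. -/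
def HasChains (b : List ℕ) : Prop :=
  ∀ la : ℕ →₀ ℕ, Antitone la → la.degree = b.sum → DomParts b la → la 0 + b.length ≤ b.sum + 1 →
    ∃ u, HasDescentChain b la u

/-- If the last row is shorter than the row above by at least one further part `q`, then there is
a chain whose last strip is not contained in the last row. -/
def HasHighChains (b : List ℕ) : Prop :=
  ∀ (q M : ℕ) (ka : ℕ →₀ ℕ), 2 ≤ q → AllStrictTriangles ((q :: b : List ℕ) : Multiset ℕ) →
    Antitone ka → ka.degree = b.sum → DomParts b ka → ka 0 + b.length ≤ b.sum + 1 →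
    0 < ka (M + 1) → (∀ i, M + 1 < i → ka i = 0) → ka (M + 1) + q ≤ ka M →
    ∃ u, u ≤ M ∧ HasDescentChain b ka u

/-- If the last row is shorter than `x`, it cannot contain the last strip. Otherwise a strip is
chosen by hand that has boxes both in the last row, to create the descent, and in a higher row, to
serve as the required box. -/
theorem HasChains.hasHighChains_cons {x : ℕ} {b : List ℕ} (h : HasChains (x :: b))
    (h1 : b ≠ [] → HasChains b) (h1' : b ≠ [] → HasHighChains b) (h2 : ∀ y ∈ x :: b, 2 ≤ y) :
    HasHighChains (x :: b) := by
  intro q M ka hq htri hanti hdeg hdom h0 hpos hlast hgap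
  have hx := h2 x (by simp)
  have h2b : ∀ y ∈ b, 2 ≤ y := fun y hy => h2 y (by simp [hy])
  rcases lt_or_ge (ka (M + 1)) x with hlt | hge
  · obtain ⟨u, hu⟩ := h ka hanti hdeg hdom h0
    obtain ⟨v, hv, hc⟩ := hu.exists_ne hlt
    refine ⟨v, ?_, hc⟩
    by_contra hcon
    have := hlast v (by omega)
    have := hc.pos
    omega
  -- With `x` the only part, the last row would use up all boxes and leave none for the longer row
  -- above.
  have hb : b ≠ [] := by
    rintro rfl
    have : ka M + ka (M + 1) ≤ ka.degree := add_le_degree (by omega)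
    simp at hdeg
    omega
  have hbig : ∀ y ∈ b, y + 1 ≤ x + q := fun y hy => by
    have := lt_add_of_allStrictTriangles htri (x := q) (y := x) (z := y) (by
      rw [← Multiset.cons_coe, ← Multiset.cons_coe]
      refine Multiset.cons_le_cons _ (Multiset.cons_le_cons _ ?_)
      simpa using hy) (by omega) (by omega)
    omega
  simp only [List.sum_cons, List.length_cons] at hdeg h0
  rcases le_or_gt (ka 0 + b.length) (b.sum + 1) with hF | hF
  -- Take one box from row `M` and the other `x - 1 ≥ 1` from the last row. The last row stays
  -- non-empty and the gap of `q` survives, so the auxiliary property applies again with the same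
  -- `q` and `M`.
  · obtain ⟨mu, hmu⟩ : ∃ mu : ℕ →₀ ℕ,
        mu + (Finsupp.single (M + 1) (x - 1) + Finsupp.single M 1) = ka := by
      refine ⟨_, tsub_add_cancel_of_le fun i => ?_⟩
      simp only [Finsupp.add_apply, Finsupp.single_apply]
      split_ifs with h3 h4 h4 <;> subst_vars <;> omega
    have hv : ∀ i, mu i + ((if M + 1 = i then x - 1 else 0) + if M = i then 1 else 0) = ka i := by
      intro i
      rw [← hmu]
      simp only [Finsupp.add_apply, Finsupp.single_apply]
    have hdegmu : mu.degree = b.sum := by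
      rw [← hmu, map_add, map_add, Finsupp.degree_single, Finsupp.degree_single] at hdeg
      omega
    have hvM := hv M
    have hvM1 := hv (M + 1)
    rw [if_neg (by omega), if_pos rfl] at hvM
    rw [if_pos rfl, if_neg (by omega)] at hvM1
    have hvo : ∀ i, i ≠ M → i ≠ M + 1 → mu i = ka i := fun i hi hi' => by
      have := hv i
      rw [if_neg (Ne.symm hi'), if_neg (Ne.symm hi)] at this
      omega
    have hstrip : IsStrip mu ka := by
      refine ⟨fun i => by have := hv i; omega, fun i => ?_⟩
      have h4 := hanti (show i ≤ i + 1 by omega)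
      by_cases h5 : i = M
      · subst h5; omega
      by_cases h6 : i = M + 1
      · subst h6; rw [hlast _ (by omega)]; omega
      · rw [hvo i h5 h6]; exact h4
    have hle0 : mu 0 ≤ ka 0 := hstrip.1 0
    obtain ⟨u, hu, hc⟩ := h1' hb q M mu hq
      (allStrictTriangles_mono htri (by
        rw [← Multiset.cons_coe, ← Multiset.cons_coe, ← Multiset.cons_coe]
        exact Multiset.cons_le_cons _ (Multiset.le_cons_self _ _)))
      hstrip.antitone_left hdegmu
      -- Row `M` had at least `x + q` boxes and lost one; the triangle inequality for `q`, `x` and a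
      -- part of `b` bounds that part by `x + q - 1`.
      (domParts_of_le hdegmu (M := M + 1) (B := x + q - 1)
        (fun i hi => by rw [hvo i (by omega) (by omega)]; exact hlast i hi)
        (fun i hi => by
          rcases eq_or_ne i M with h5 | h5
          · subst h5; omega
          · have := hanti (show i ≤ M by omega)
            rw [hvo i h5 (by omega)]; omega)
        fun y hy => by have := hbig y hy; omega)
      (by omega) (by omega)
      (fun i hi => by rw [hvo i (by omega) (by omega)]; exact hlast i hi) (by omega)
    exact ⟨M, le_rfl, .cons hc hstrip (by omega) (show u < M + 1 by omega) (by omega) (by omega)⟩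
  -- The first row exceeds by `e` the maximum possible for `b`. Taking `e` boxes from it makes it
  -- extremal, and the bound on `ka 0` leaves `x - e ≥ 1` boxes for the last row.
  · obtain ⟨e, he⟩ : ∃ e, ka 0 + b.length = b.sum + 1 + e := ⟨_, (Nat.add_sub_of_le hF.le).symm⟩
    have h10 := row_one_le hanti (q := x) (b := b) (by simpa using hdeg) hdom h2b
      (allStrictTriangles_mono htri (by
        rw [← Multiset.cons_coe q]; exact Multiset.le_cons_self _ _)) hb
    obtain ⟨mu, hmu⟩ : ∃ mu : ℕ →₀ ℕ,
        mu + (Finsupp.single (M + 1) (x - e) + Finsupp.single 0 e) = ka := by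
      refine ⟨_, tsub_add_cancel_of_le fun i => ?_⟩
      simp only [Finsupp.add_apply, Finsupp.single_apply]
      split_ifs with h3 h4 h4 <;> subst_vars <;> omega
    have hv : ∀ i, mu i + ((if M + 1 = i then x - e else 0) + if 0 = i then e else 0) = ka i := by
      intro i
      rw [← hmu]
      simp only [Finsupp.add_apply, Finsupp.single_apply]
    have hdegmu : mu.degree = b.sum := by
      rw [← hmu, map_add, map_add, Finsupp.degree_single, Finsupp.degree_single] at hdeg
      omega
    have hv0 := hv 0
    have hvM1 := hv (M + 1)
    rw [if_neg (by omega), if_pos rfl] at hv0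
    rw [if_pos rfl, if_neg (by omega)] at hvM1
    have hstrip : IsStrip mu ka := by
      refine ⟨fun i => by have := hv i; omega, fun i => ?_⟩
      have h4 := hanti (show i ≤ i + 1 by omega)
      by_cases h5 : i = 0
      · subst h5; simp only [zero_add]; omega
      by_cases h6 : i = M + 1
      · subst h6; rw [hlast _ (by omega)]; omega
      · have := hv i
        rw [if_neg (Ne.symm h6), if_neg (Ne.symm h5)] at this
        omega
    have h00 : mu 0 + b.length = b.sum + 1 := by omega
    obtain ⟨u, hc⟩ := h1 hb mu hstrip.antitone_left hdegmu
      (domParts_of_zero_row_eq hstrip.antitone_left hdegmu h00 h2b) h00.le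
    exact ⟨0, Nat.zero_le _, .cons (hc.of_zero_row_eq h00 h2b) hstrip (by omega)
      (show 0 < M + 1 by omega) (by omega) (by omega)⟩

theorem hasChains_singleton {x : ℕ} (hx : 0 < x) : HasChains [x] := by
  intro la hanti hdeg hdom h0
  have h1 : x ≤ la 0 := DomParts.le_zero_row (b := 0) hdom
  have h2 : la = Finsupp.single 0 x := by
    ext i
    rw [Finsupp.single_apply]
    simp only [List.length_singleton, List.sum_singleton] at *
    split_ifs with h3
    · subst h3; omega
    · have := add_le_degree (ka := la) h3
      omega
  rw [h2]
  exact ⟨0, .single x hx⟩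

/-- Where the partial sums of `la` are unchanged, its dominance applies directly; elsewhere `x` is
added to the chosen parts and the inequality one row further is used. -/
theorem DomParts.of_lowest_strip {x : ℕ} {b : Multiset ℕ} {la mu : ℕ →₀ ℕ}
    (h : DomParts (x ::ₘ b) la)
    (hmu : ∀ j, ∑ i ∈ range j, mu i = ∑ i ∈ range j, la i ∨
      ∑ i ∈ range j, mu i + x = ∑ i ∈ range (j + 1), la i) : DomParts b mu := by
  intro s hs
  rcases hmu (Multiset.card s) with h1 | h1
  · rw [h1]
    exact h s (hs.trans (Multiset.le_cons_self _ _))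
  · have := h (x ::ₘ s) (Multiset.cons_le_cons _ hs)
    rw [Multiset.sum_cons, Multiset.card_cons] at this
    omega

/-- The lowest strip is removed when the remaining first row is admissible; otherwise the strip is
modified to leave a first row of maximal length. -/
theorem hasChains_cons {x : ℕ} {b : List ℕ} (hb : b ≠ []) (h1 : HasChains b)
    (h1' : HasHighChains b) (h2 : ∀ y ∈ x :: b, 2 ≤ y)
    (htri : AllStrictTriangles ((x :: b : List ℕ) : Multiset ℕ)) : HasChains (x :: b) := by
  intro la hanti hdeg hdom h0
  have hx := h2 x (by simp)
  have h2b : ∀ y ∈ b, 2 ≤ y := fun y hy => h2 y (by simp [hy])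
  have hx0 : x ≤ la 0 := DomParts.le_zero_row (b := b) hdom
  have h10 := row_one_le hanti (q := x) (b := b) (by simpa using hdeg) hdom h2b htri hb
  have hlen := List.length_pos_iff.2 hb
  simp only [List.sum_cons, List.length_cons] at hdeg h0
  obtain ⟨M, hM, hlast⟩ := exists_last_row hanti (by omega)
  have hM0 : M ≠ 0 := by
    rintro rfl
    have := sum_range_eq_degree (la := la) (N := 1) fun i hi => hlast i (by omega)
    simp at this
    omega
  obtain ⟨mu, hstrip, -, hdegmu, hpart, hmu0, hbot⟩ :=
    exists_lowest_strip hanti (c := 0) (g := x) (by omega) hx0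
  have hle0 : mu 0 ≤ la 0 := hstrip.1 0
  have hmlast : ∀ i, M < i → mu i = 0 := fun i hi =>
    Nat.le_zero.1 ((hstrip.1 i).trans (hlast i hi).le)
  rcases le_or_gt (mu 0 + b.length) (b.sum + 1) with hF | hF
  · have hdm : DomParts b mu := DomParts.of_lowest_strip hdom hpart
    rcases hbot M hlast with hz | hs
    · obtain ⟨u, hc⟩ := h1 mu hstrip.antitone_left (by omega) hdm hF
      refine ⟨M, .cons hc hstrip (by omega) (show u < M from ?_) (by omega) (by omega)⟩
      by_contra hcon
      have := hc.pos
      rcases eq_or_lt_of_le (not_lt.1 hcon) with h5 | h5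
      · subst h5; omega
      · have := hmlast u h5; omega
    · have hsM := hs M
      rw [Finsupp.single_eq_same] at hsM
      by_cases hz : mu M = 0
      · obtain ⟨u, hc⟩ := h1 mu hstrip.antitone_left (by omega) hdm hF
        refine ⟨M, .cons hc hstrip (by omega) (show u < M from ?_) (by omega) (by omega)⟩
        by_contra hcon
        have := hc.pos
        rcases eq_or_lt_of_le (not_lt.1 hcon) with h5 | h5
        · subst h5; omega
        · have := hmlast u h5; omega
      obtain ⟨K, rfl⟩ : ∃ K, M = K + 1 := ⟨M - 1, by omega⟩
      have hsK := hs K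
      rw [Finsupp.single_eq_of_ne (by omega)] at hsK
      have := hanti (show K ≤ K + 1 by omega)
      obtain ⟨u, hu, hc⟩ := h1' x K mu hx htri hstrip.antitone_left (by omega) hdm hF (by omega)
        hmlast (by omega)
      exact ⟨K + 1, .cons hc hstrip (by omega) (show u < K + 1 by omega) (by omega) (by omega)⟩
  · obtain ⟨e, he⟩ : ∃ e, la 0 + b.length = b.sum + 1 + e :=
      ⟨_, (Nat.add_sub_of_le (show b.sum + 1 ≤ la 0 + b.length by omega)).symm⟩
    -- If `x` exceeds the second row, the lowest strip leaves `la 0 + la 1 - x` boxes in row 0, and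
    -- that this is still too long means `x - e < la 1`.
    have hg1 : x - e ≤ la 1 := by
      rcases le_or_gt x (la 1) with h5 | h5
      · omega
      · have := hmu0 h5
        simp only [zero_add] at this
        omega
    obtain ⟨nu, hnstrip, hnlow, hdegnu, -⟩ :=
      exists_lowest_strip hanti (c := 1) (g := x - e) (by omega) hg1
    have hn0 := hnlow 0 (by omega)
    obtain ⟨rho, hrho⟩ : ∃ rho : ℕ →₀ ℕ, rho + Finsupp.single 0 e = nu := by
      refine ⟨_, tsub_add_cancel_of_le fun i => ?_⟩
      simp only [Finsupp.single_apply]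
      split_ifs with h3
      · subst h3; omega
      · omega
    have hv : ∀ i, rho i + (if 0 = i then e else 0) = nu i := by
      intro i
      rw [← hrho]
      simp only [Finsupp.add_apply, Finsupp.single_apply]
    have hv0 := hv 0
    rw [if_pos rfl] at hv0
    have hvo : ∀ i, i ≠ 0 → rho i = nu i := fun i hi => by
      have := hv i
      rw [if_neg (Ne.symm hi)] at this
      omega
    have hdegrho : rho.degree = b.sum := by
      rw [← hrho, map_add, Finsupp.degree_single] at hdegnu
      omega
    have hrstrip : IsStrip rho la := by
      refine ⟨fun i => by have := hv i; have := hnstrip.1 i; omega, fun i => ?_⟩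
      rcases eq_or_ne i 0 with h5 | h5
      · subst h5; simp only [zero_add]; omega
      · rw [hvo i h5]; exact hnstrip.2 i
    have h00 : rho 0 + b.length = b.sum + 1 := by omega
    obtain ⟨u, hc⟩ := h1 rho hrstrip.antitone_left hdegrho
      (domParts_of_zero_row_eq hrstrip.antitone_left hdegrho h00 h2b) h00.le
    -- The `x - e ≥ 1` boxes below the first row supply the descent from a strip that meets row 0.
    obtain ⟨i, hi0, hi⟩ : ∃ i, 0 < i ∧ rho i < la i := by
      by_contra! hcon
      have : nu = la := by
        ext i
        rcases eq_or_ne i 0 with h5 | h5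
        · rw [h5, hn0]
        · have := hcon i (by omega)
          have := hnstrip.1 i
          rw [hvo i h5] at *
          omega
      rw [this] at hdegnu
      omega
    exact ⟨i, .cons (hc.of_zero_row_eq h00 h2b) hrstrip (by omega) hi0 hi hi⟩

/-- Under the triangle inequalities, every shape in the interval has a chain. -/
theorem hasChains {b : List ℕ} (hb : b ≠ []) (h2 : ∀ y ∈ b, 2 ≤ y)
    (htri : AllStrictTriangles (b : Multiset ℕ)) : HasChains b := by
  suffices h : HasChains b ∧ HasHighChains b from h.1
  induction b with
  | nil => exact absurd rfl hb
  | cons x b ih =>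
    have ih' := fun hb => ih hb (fun y hy => h2 y (by simp [hy]))
      (allStrictTriangles_mono htri (by
        rw [← Multiset.cons_coe x]; exact Multiset.le_cons_self _ _))
    have h : HasChains (x :: b) := by
      rcases eq_or_ne b [] with rfl | hb
      · exact hasChains_singleton (by have := h2 x (by simp); omega)
      · exact hasChains_cons hb (ih' hb).1 (ih' hb).2 h2 htri
    exact ⟨h, h.hasHighChains_cons (fun hb => (ih' hb).1) (fun hb => (ih' hb).2) h2⟩

/-! ### Words with prescribed ascents and noncommutative ribbon sums -/

/-- The word `w` has an ascent at position `k` exactly if the `k`-th entry of the pattern is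
`true`. -/
def HasPattern : List Bool → List ℕ → Prop
  | [], w => ∃ a, w = [a]
  | c :: p, w => ∃ a a' w', w = a :: a' :: w' ∧ (a < a' ↔ c = true) ∧ HasPattern p (a' :: w')

/-- Words with a given pattern, first letter `a` and the other letters below `N`. -/
def wordsFrom (N : ℕ) : List Bool → ℕ → Finset (List ℕ)
  | [], a => {[a]}
  | c :: p, a => ((range N).filter fun a' => a < a' ↔ c = true).biUnion fun a' =>
      (wordsFrom N p a').image (a :: ·)

/-- Words with a given pattern and letters below `N`. -/
def words (N : ℕ) (p : List Bool) : Finset (List ℕ) := (range N).biUnion (wordsFrom N p)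

theorem exists_eq_cons_of_mem_wordsFrom {N : ℕ} {p : List Bool} {a : ℕ} {w : List ℕ}
    (h : w ∈ wordsFrom N p a) : ∃ w', w = a :: w' := by
  cases p with
  | nil => exact ⟨[], by simpa [wordsFrom] using h⟩
  | cons c p =>
    simp only [wordsFrom, mem_biUnion, mem_image] at h
    obtain ⟨a', -, w', -, rfl⟩ := h
    exact ⟨w', rfl⟩

theorem mem_wordsFrom {N : ℕ} {p : List Bool} {a : ℕ} {w : List ℕ} :
    w ∈ wordsFrom N p a ↔ HasPattern p w ∧ ∃ w', w = a :: w' ∧ ∀ y ∈ w', y < N := by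
  induction p generalizing a w with
  | nil =>
    simp only [wordsFrom, mem_singleton, HasPattern]
    constructor
    · rintro rfl
      exact ⟨⟨a, rfl⟩, [], rfl, by simp⟩
    · rintro ⟨⟨b, rfl⟩, w', h, -⟩
      simp only [List.cons.injEq] at h
      rw [h.1]
  | cons c p ih =>
    simp only [wordsFrom, mem_biUnion, mem_image, mem_filter, mem_range, HasPattern]
    constructor
    · rintro ⟨a', ⟨ha', hc⟩, w', hw', rfl⟩
      obtain ⟨hp, w'', rfl, hlt⟩ := ih.1 hw'
      exact ⟨⟨a, a', w'', rfl, hc, hp⟩, a' :: w'', rfl, by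
        simpa only [List.mem_cons, forall_eq_or_imp] using ⟨ha', hlt⟩⟩
    · rintro ⟨⟨b, a', w', rfl, hc, hp⟩, w'', h, hlt⟩
      simp only [List.cons.injEq] at h
      obtain ⟨rfl, rfl⟩ := h
      simp only [List.mem_cons, forall_eq_or_imp] at hlt
      exact ⟨a', ⟨hlt.1, hc⟩, a' :: w', ih.2 ⟨hp, w', rfl, hlt.2⟩, rfl⟩

theorem mem_words {N : ℕ} {p : List Bool} {w : List ℕ} :
    w ∈ words N p ↔ HasPattern p w ∧ ∀ y ∈ w, y < N := by
  simp only [words, mem_biUnion, mem_range, mem_wordsFrom]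
  constructor
  · rintro ⟨a, ha, hp, w', rfl, h⟩
    exact ⟨hp, by simpa using ⟨ha, h⟩⟩
  · rintro ⟨hp, h⟩
    cases w with
    | nil =>
      cases p with
      | nil => obtain ⟨a, ha⟩ := hp; cases ha
      | cons c p => obtain ⟨a, a', w', ha, -⟩ := hp; cases ha
    | cons a w =>
      simp only [List.mem_cons, forall_eq_or_imp] at h
      exact ⟨a, h.1, hp, w, rfl, h.2⟩

section WordSums

variable {A : Type*} [Semiring A]

/-- The sum of the products of the letters over all words with a given pattern and first letter. -/
def wordSumFrom (u : ℕ → A) (N : ℕ) (p : List Bool) (a : ℕ) : A :=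
  ∑ w ∈ wordsFrom N p a, (w.map u).prod

/-- The sum of the products of the letters over all words with a given pattern: a
noncommutative ribbon Schur function. -/
def wordSum (u : ℕ → A) (N : ℕ) (p : List Bool) : A :=
  ∑ w ∈ words N p, (w.map u).prod

theorem pairwiseDisjoint_wordsFrom (N : ℕ) (p : List Bool) (s : Set ℕ) :
    s.PairwiseDisjoint (wordsFrom N p) := by
  intro a _ b _ hab
  refine Finset.disjoint_left.2 fun w hw hw' => hab ?_
  obtain ⟨v, rfl⟩ := exists_eq_cons_of_mem_wordsFrom hw
  obtain ⟨v', h⟩ := exists_eq_cons_of_mem_wordsFrom hw'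
  simp only [List.cons.injEq] at h
  exact h.1

theorem wordSum_eq (u : ℕ → A) (N : ℕ) (p : List Bool) :
    wordSum u N p = ∑ a ∈ range N, wordSumFrom u N p a :=
  Finset.sum_biUnion (pairwiseDisjoint_wordsFrom N p _)

theorem wordSumFrom_nil (u : ℕ → A) (N a : ℕ) : wordSumFrom u N [] a = u a := by
  simp [wordSumFrom, wordsFrom]

theorem wordSumFrom_cons (u : ℕ → A) (N : ℕ) (c : Bool) (p : List Bool) (a : ℕ) :
    wordSumFrom u N (c :: p) a =
      u a * ∑ a' ∈ (range N).filter (fun a' => a < a' ↔ c = true), wordSumFrom u N p a' := by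
  unfold wordSumFrom
  rw [wordsFrom, Finset.sum_biUnion, Finset.mul_sum]
  · refine Finset.sum_congr rfl fun a' _ => ?_
    rw [Finset.sum_image fun _ _ _ _ h => (List.cons.inj h).2, Finset.mul_sum]
    refine Finset.sum_congr rfl fun w _ => ?_
    rw [List.map_cons, List.prod_cons]
  · intro b hb b' hb' hbb'
    refine Finset.disjoint_left.2 fun w hw hw' => ?_
    obtain ⟨v, hv, rfl⟩ := mem_image.1 hw
    obtain ⟨v', hv', h⟩ := mem_image.1 hw'
    rw [(List.cons.inj h).2] at hv'
    exact Finset.disjoint_left.1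
      (pairwiseDisjoint_wordsFrom N p Set.univ (Set.mem_univ b) (Set.mem_univ b') hbb') hv hv'

/-- At the junction of two concatenated words there either is an ascent or there is none. Fixing the
first letter makes the induction on `q` possible. -/
theorem wordSumFrom_append (u : ℕ → A) (N : ℕ) (q p : List Bool) (a : ℕ) :
    wordSumFrom u N (q ++ true :: p) a + wordSumFrom u N (q ++ false :: p) a =
      wordSumFrom u N q a * wordSum u N p := by
  induction q generalizing a with
  | nil =>
    rw [List.nil_append, List.nil_append, wordSumFrom_cons, wordSumFrom_cons, wordSumFrom_nil,
      wordSum_eq, ← mul_add]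
    congr 1
    rw [← Finset.sum_filter_add_sum_filter_not (range N) (fun a' => a < a')]
    simp
  | cons c q ih =>
    rw [List.cons_append, List.cons_append, wordSumFrom_cons, wordSumFrom_cons, wordSumFrom_cons,
      ← mul_add, ← Finset.sum_add_distrib, mul_assoc, Finset.sum_mul]
    congr 1
    exact Finset.sum_congr rfl fun a' _ => ih a'

theorem wordSum_append (u : ℕ → A) (N : ℕ) (q p : List Bool) :
    wordSum u N (q ++ true :: p) + wordSum u N (q ++ false :: p) =
      wordSum u N q * wordSum u N p := by
  rw [wordSum_eq, wordSum_eq, wordSum_eq u N q, ← Finset.sum_add_distrib, Finset.sum_mul]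
  exact Finset.sum_congr rfl fun a _ => wordSumFrom_append u N q p a

end WordSums

theorem eq_replicate_or_append (p : List Bool) :
    (∃ r, p = List.replicate r false) ∨
      ∃ r p', p = List.replicate r false ++ true :: p' := by
  induction p with
  | nil => exact Or.inl ⟨0, rfl⟩
  | cons c p ih =>
    cases c with
    | true => exact Or.inr ⟨0, p, rfl⟩
    | false =>
      rcases ih with ⟨r, rfl⟩ | ⟨r, p', rfl⟩
      · exact Or.inl ⟨r + 1, rfl⟩
      · exact Or.inr ⟨r + 1, p', rfl⟩

/-- A common eigenvector of the sums over weakly decreasing words is an eigenvector of every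
ribbon sum. -/
theorem wordSum_apply_eq_smul {R V : Type*} [CommRing R] [AddCommGroup V] [Module R V]
    (D : ℕ → Module.End R V) (x : ℕ → R) (N : ℕ) (Φ : V)
    (h : ∀ r, wordSum D N (List.replicate r false) Φ =
      wordSum x N (List.replicate r false) • Φ) (p : List Bool) :
    wordSum D N p Φ = wordSum x N p • Φ := by
  -- At the first ascent, both the word sum after the cut and the merged pattern without that ascent
  -- have one `true` fewer, so the product formula determines the remaining ribbon sum.
  induction hk : p.count true using Nat.strong_induction_on generalizing p with
  | _ k ih =>
    rcases eq_replicate_or_append p with ⟨r, rfl⟩ | ⟨r, p', rfl⟩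
    · exact h r
    · have hc : (List.replicate r false).count true = 0 := by
        rw [List.count_replicate]; simp
      rw [List.count_append, hc, List.count_cons_self, zero_add] at hk
      have h1 := ih (p'.count true) (by omega) p' rfl
      have h2 := ih (p'.count true) (by omega) (List.replicate r false ++ false :: p') (by
        rw [List.count_append, hc, List.count_cons_of_ne (by simp), zero_add])
      have h3 := congrArg (fun T : Module.End R V => T Φ)
        (wordSum_append D N (List.replicate r false) p')
      simp only [LinearMap.add_apply, Module.End.mul_apply] at h3
      rw [h1, map_smul, h, h2, ← eq_sub_iff_add_eq] at h3
      rw [h3, smul_smul, ← sub_smul]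
      congr 1
      rw [sub_eq_iff_eq_add, wordSum_append, mul_comm]

/-! ### Lattice words and box-adding operators -/

/-- The multiplicities of the letters of a word. -/
noncomputable def content (w : List ℕ) : ℕ →₀ ℕ := (w.map fun a => Finsupp.single a 1).sum

theorem content_cons (a : ℕ) (w : List ℕ) :
    content (a :: w) = Finsupp.single a 1 + content w := by
  simp [content]

theorem content_nil : content [] = 0 := rfl

theorem content_append (v w : List ℕ) : content (v ++ w) = content v + content w := by
  simp [content]

theorem content_apply (w : List ℕ) (a : ℕ) : content w a = w.count a := by
  induction w with
  | nil => rfl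
  | cons b w ih =>
    rw [content_cons, Finsupp.add_apply, ih, List.count_cons, Finsupp.single_apply, add_comm]
    simp

theorem degree_content (w : List ℕ) : (content w).degree = w.length := by
  induction w with
  | nil => simp [content_nil]
  | cons b w ih => rw [content_cons, map_add, ih, Finsupp.degree_single, List.length_cons, add_comm]

/-- Starting from the shape `la`, adding boxes in the rows given by the letters of `w` gives
partitions throughout. -/
def IsLattice : (ℕ →₀ ℕ) → List ℕ → Prop
  | _, [] => True
  | la, a :: w => IsStrip la (la + Finsupp.single a 1) ∧ IsLattice (la + Finsupp.single a 1) w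

theorem isLattice_append {la : ℕ →₀ ℕ} {v w : List ℕ} :
    IsLattice la (v ++ w) ↔ IsLattice la v ∧ IsLattice (la + content v) w := by
  induction v generalizing la with
  | nil => simp [IsLattice, content_nil]
  | cons a v ih =>
    rw [List.cons_append, IsLattice, IsLattice, ih, content_cons, and_assoc, add_assoc]

theorem IsLattice.antitone {la : ℕ →₀ ℕ} {w : List ℕ} (h : IsLattice la w) (hla : Antitone la) :
    Antitone ⇑(la + content w) := by
  induction w generalizing la with
  | nil => rwa [content_nil, add_zero]
  | cons a w ih =>
    rw [content_cons, ← add_assoc]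
    exact ih h.2 h.1.antitone_right

/-- Adding boxes along a weakly decreasing word amounts to adding a horizontal strip. -/
theorem isLattice_iff_isStrip {ka : ℕ →₀ ℕ} {w : List ℕ} (hw : w.Pairwise (· ≥ ·)) (h0 : w ≠ []) :
    IsLattice ka w ↔ IsStrip ka (ka + content w) := by
  induction w generalizing ka with
  | nil => exact absurd rfl h0
  | cons a w ih =>
    rcases eq_or_ne w [] with rfl | hw'
    · simp [IsLattice, content_cons, content_nil]
    · rw [IsLattice, ih hw.of_cons hw', content_cons, ← add_assoc]
      -- Later letters never exceed `a`, so row `a + 1` is already final when a box is added to row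
      -- `a`; the strip condition compares exactly this final row with the original row `a`.
      have hc : ∀ t, a < t → content w t = 0 := by
        intro t ht
        rw [content_apply, List.count_eq_zero]
        intro hmem
        have := List.rel_of_pairwise_cons hw hmem
        omega
      constructor
      · rintro ⟨h1, h2⟩
        refine ⟨fun i => (h1.1 i).trans (h2.1 i), fun i => ?_⟩
        rcases eq_or_ne i a with rfl | hi
        · have h3 := h1.2 i
          simp only [Finsupp.add_apply, hc (i + 1) (by omega), add_zero] at h3 ⊢
          exact h3
        · have h3 := h2.2 i
          simp only [Finsupp.add_apply, Finsupp.single_eq_of_ne hi, add_zero] at h3 ⊢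
          exact h3
      · rintro h
        refine ⟨⟨fun i => ?_, fun i => ?_⟩, ⟨fun i => ?_, fun i => ?_⟩⟩
        · simp
        · have := h.2 i
          simp only [Finsupp.add_apply] at this ⊢
          omega
        · simp
        · have := h.2 i
          simp only [Finsupp.add_apply] at this ⊢
          omega

open Classical in
/-- The operator on functions of shapes that adds a box to row `a` of the argument, with value `0`
if this does not give a partition. -/
noncomputable def addBox (R : Type*) [CommRing R] (a : ℕ) : Module.End R ((ℕ →₀ ℕ) → R) where
  toFun f la := if IsStrip la (la + Finsupp.single a 1) then f (la + Finsupp.single a 1) else 0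
  map_add' f g := by
    ext la
    simp only [Pi.add_apply]
    split_ifs <;> simp
  map_smul' c f := by
    ext la
    simp only [Pi.smul_apply, RingHom.id_apply]
    split_ifs <;> simp

open Classical in
theorem prod_map_addBox_apply {R : Type*} [CommRing R] (w : List ℕ) (f : (ℕ →₀ ℕ) → R)
    (la : ℕ →₀ ℕ) : (w.map (addBox R)).prod f la =
      if IsLattice la w then f (la + content w) else 0 := by
  induction w generalizing la with
  | nil => simp [IsLattice, content_nil]
  | cons a w ih =>
    rw [List.map_cons, List.prod_cons, Module.End.mul_apply, content_cons, ← add_assoc, IsLattice]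
    show (if IsStrip la (la + Finsupp.single a 1) then
      (w.map (addBox R)).prod f (la + Finsupp.single a 1) else 0) = _
    rw [ih]
    split_ifs with h1 h2 h3 h3 h3 <;> first | rfl | (exfalso; tauto)

open Classical in
theorem wordSum_addBox_apply {R : Type*} [CommRing R] (N : ℕ) (p : List Bool)
    (f : (ℕ →₀ ℕ) → R) (la : ℕ →₀ ℕ) : wordSum (addBox R) N p f la =
      ∑ w ∈ words N p, if IsLattice la w then f (la + content w) else 0 := by
  unfold wordSum
  rw [LinearMap.sum_apply, Finset.sum_apply]
  exact Finset.sum_congr rfl fun w _ => prod_map_addBox_apply w f la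

theorem hasPattern_replicate {r : ℕ} {w : List ℕ} : HasPattern (List.replicate r false) w ↔
    w.Pairwise (· ≥ ·) ∧ w.length = r + 1 := by
  induction r generalizing w with
  | zero =>
    simp only [List.replicate_zero, HasPattern, zero_add]
    constructor
    · rintro ⟨a, rfl⟩
      simp
    · rintro ⟨-, h⟩
      exact List.length_eq_one_iff.1 h
  | succ r ih =>
    simp only [List.replicate_succ, HasPattern, ih]
    constructor
    · rintro ⟨a, a', w, rfl, h1, h2, h3⟩
      refine ⟨?_, by rw [List.length_cons, h3]⟩
      rw [List.pairwise_cons] at h2 ⊢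
      refine ⟨fun b hb => ?_, List.pairwise_cons.2 h2⟩
      simp only [Bool.false_eq_true, iff_false, not_lt] at h1
      rcases List.mem_cons.1 hb with rfl | hb
      · exact h1
      · exact (h2.1 b hb).trans h1
    · rintro ⟨h2, h3⟩
      match w, h3 with
      | a :: a' :: w, h3 =>
        refine ⟨a, a', w, rfl, ?_, h2.of_cons, by simpa using h3⟩
        have := List.rel_of_pairwise_cons h2 (List.mem_cons_self)
        simpa using this

/-- A weakly decreasing word is determined by its content; `r` non-ascents mean `r + 1` letters. -/
theorem sum_content_words {B : Type*} [AddCommMonoid B] (N r : ℕ) (F : (ℕ →₀ ℕ) → B) :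
    ∑ w ∈ words N (List.replicate r false), F (content w) =
      ∑ X ∈ finsuppAntidiag (range N) (r + 1), F X := by
  have hcont : ∀ w : List ℕ, content w = Multiset.toFinsupp (w : Multiset ℕ) := fun w => by
    ext a
    rw [content_apply, Multiset.toFinsupp_apply, Multiset.coe_count]
  refine Finset.sum_bij (fun w _ => content w) ?_ ?_ ?_ fun _ _ => rfl
  · intro w hw
    rw [mem_words, hasPattern_replicate] at hw
    rw [mem_finsuppAntidiag]
    have hsub : (content w).support ⊆ range N := fun a ha => by
      rw [Finsupp.mem_support_iff, content_apply, Ne, List.count_eq_zero, not_not] at ha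
      exact mem_range.2 (hw.2 a ha)
    refine ⟨?_, hsub⟩
    rw [← hw.1.2, ← degree_content, Finsupp.degree_apply]
    exact (Finset.sum_subset hsub fun i _ hi => by simpa using hi).symm
  · intro w hw v hv h
    rw [mem_words, hasPattern_replicate] at hw hv
    rw [hcont, hcont, EmbeddingLike.apply_eq_iff_eq, Multiset.coe_eq_coe] at h
    exact h.eq_of_pairwise (fun a b _ _ h1 h2 => le_antisymm h2 h1) hw.1.1 hv.1.1
  · intro X hX
    rw [mem_finsuppAntidiag] at hX
    have h1 : content ((Finsupp.toMultiset X).sort (· ≥ ·)) = X := by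
      rw [hcont, Multiset.sort_eq, Finsupp.toMultiset_toFinsupp]
    refine ⟨_, ?_, h1⟩
    rw [mem_words, hasPattern_replicate]
    refine ⟨⟨Multiset.pairwise_sort _ _, ?_⟩, fun y hy => ?_⟩
    · rw [← degree_content, h1, ← hX.1, Finsupp.degree_apply]
      exact (Finset.sum_subset hX.2 fun i _ hi => by simpa using hi)
    · rw [Multiset.mem_sort, Finsupp.mem_toMultiset] at hy
      exact mem_range.1 (hX.2 hy)

/-! ### Commutation of adding and removing horizontal strips -/

theorem finite_strips_above (mu : ℕ →₀ ℕ) (r : ℕ) :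
    {nu : ℕ →₀ ℕ | IsStrip mu nu ∧ nu.degree = mu.degree + r}.Finite := by
  obtain ⟨N, hN⟩ := exists_forall_ge_eq_zero mu
  refine ((finsuppAntidiag (range (N + 1)) (mu.degree + r)).finite_toSet).subset fun nu hnu => ?_
  have hz : ∀ i, N + 1 ≤ i → nu i = 0 := fun i hi => by
    obtain ⟨k, rfl⟩ : ∃ k, i = k + 1 := ⟨i - 1, by omega⟩
    exact Nat.le_zero.1 ((hnu.1.2 k).trans (hN k (by omega)).le)
  rw [mem_coe, mem_finsuppAntidiag, sum_range_eq_degree hz]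
  refine ⟨hnu.2, fun i hi => ?_⟩
  rw [mem_range]
  by_contra h
  exact (Finsupp.mem_support_iff.1 hi) (hz i (by omega))

/-- The shapes obtained from `mu` by adding a horizontal strip of size `r`. -/
noncomputable def stripsAbove (mu : ℕ →₀ ℕ) (r : ℕ) : Finset (ℕ →₀ ℕ) :=
  (finite_strips_above mu r).toFinset

theorem mem_stripsAbove {mu nu : ℕ →₀ ℕ} {r : ℕ} :
    nu ∈ stripsAbove mu r ↔ IsStrip mu nu ∧ nu.degree = mu.degree + r := by
  simp [stripsAbove]

open Classical in
/-- The shapes obtained from `la` by removing a horizontal strip. -/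
noncomputable def stripsBelow (la : ℕ →₀ ℕ) : Finset (ℕ →₀ ℕ) :=
  (Finset.Iic la).filter fun ka => IsStrip ka la

theorem mem_stripsBelow {ka la : ℕ →₀ ℕ} : ka ∈ stripsBelow la ↔ IsStrip ka la := by
  classical
  rw [stripsBelow, mem_filter, mem_Iic, and_iff_right_iff_imp]
  exact fun h => h.1

theorem IsStrip.degree_le {ka la : ℕ →₀ ℕ} (h : IsStrip ka la) : ka.degree ≤ la.degree := by
  obtain ⟨X, rfl⟩ := h.exists_add
  simp

/-- The finitely supported function with values `f i` for `i < N`. -/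
noncomputable def truncate (N : ℕ) (f : ℕ → ℕ) : ℕ →₀ ℕ :=
  Finsupp.onFinset (range N) (fun i => if i < N then f i else 0) fun i hi => by
    by_contra h
    rw [mem_range] at h
    exact hi (if_neg h)

theorem truncate_apply {N : ℕ} {f : ℕ → ℕ} (h : ∀ i, N ≤ i → f i = 0) (i : ℕ) :
    truncate N f i = f i := by
  show (if i < N then f i else 0) = f i
  split_ifs with hi
  · rfl
  · exact (h i (by omega)).symm

theorem eq_zero_of_support_sup_lt {la : ℕ →₀ ℕ} {i : ℕ} (h : la.support.sup id < i) :
    la i = 0 := by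
  by_contra h'
  have := Finset.le_sup (f := id) (Finsupp.mem_support_iff.2 h')
  simp only [id] at this
  omega

/-- The sum of the admissible extreme values for the `i`-th row of a shape below `mu` and `ka`
(equivalently for the next row of a shape above them). -/
def toggleSum (mu ka : ℕ →₀ ℕ) (i : ℕ) : ℕ := min (mu i) (ka i) + max (mu (i + 1)) (ka (i + 1))

theorem toggleSum_eq_zero {mu ka : ℕ →₀ ℕ} {i : ℕ}
    (h : mu.support.sup id + ka.support.sup id + 1 ≤ i) : toggleSum mu ka i = 0 := by
  unfold toggleSum
  rw [eq_zero_of_support_sup_lt (la := mu) (i := i) (by omega),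
    eq_zero_of_support_sup_lt (la := mu) (i := i + 1) (by omega),
    eq_zero_of_support_sup_lt (la := ka) (i := i + 1) (by omega)]
  simp

/-- The shape below `mu` and `ka` corresponding to a shape `nu` above them. -/
noncomputable def toggleDown (mu ka nu : ℕ →₀ ℕ) : ℕ →₀ ℕ :=
  truncate (mu.support.sup id + ka.support.sup id + 1) fun i => toggleSum mu ka i - nu (i + 1)

theorem toggleDown_apply (mu ka nu : ℕ →₀ ℕ) (i : ℕ) :
    toggleDown mu ka nu i = toggleSum mu ka i - nu (i + 1) :=
  truncate_apply (fun i hi => by rw [toggleSum_eq_zero hi, Nat.zero_sub]) i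

/-- The shape above `mu` and `ka` corresponding to a shape `rho` below them and an excess `j` of
the first row. -/
noncomputable def toggleUp (mu ka rho : ℕ →₀ ℕ) (j : ℕ) : ℕ →₀ ℕ :=
  truncate (mu.support.sup id + ka.support.sup id + 2) fun i =>
    Nat.casesOn i (max (mu 0) (ka 0) + j) fun i => toggleSum mu ka i - rho i

theorem toggleUp_apply (mu ka rho : ℕ →₀ ℕ) (j i : ℕ) : toggleUp mu ka rho j i =
    Nat.casesOn i (max (mu 0) (ka 0) + j) fun i => toggleSum mu ka i - rho i :=
  truncate_apply (fun i hi => by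
    obtain ⟨k, rfl⟩ : ∃ k, i = k + 1 := ⟨i - 1, by omega⟩
    show toggleSum mu ka k - rho k = 0
    rw [toggleSum_eq_zero (by omega), Nat.zero_sub]) i

theorem toggleUp_zero (mu ka rho : ℕ →₀ ℕ) (j : ℕ) :
    toggleUp mu ka rho j 0 = max (mu 0) (ka 0) + j :=
  toggleUp_apply mu ka rho j 0

theorem toggleUp_succ (mu ka rho : ℕ →₀ ℕ) (j i : ℕ) :
    toggleUp mu ka rho j (i + 1) = toggleSum mu ka i - rho i :=
  toggleUp_apply mu ka rho j (i + 1)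

/-- Because min plus max is the plain sum, the toggle relations add up to the sizes of `mu` and `ka`
except for the maximum in row 0, which `nu 0` supplies together with `j`. -/
theorem degree_toggle {mu ka rho nu : ℕ →₀ ℕ} {j : ℕ}
    (h : ∀ i, rho i + nu (i + 1) = toggleSum mu ka i) (h0 : nu 0 = max (mu 0) (ka 0) + j) :
    rho.degree + nu.degree = mu.degree + ka.degree + j := by
  obtain ⟨N1, h1⟩ := exists_forall_ge_eq_zero mu
  obtain ⟨N2, h2⟩ := exists_forall_ge_eq_zero ka
  obtain ⟨N, hN1, hN2⟩ : ∃ N, N1 ≤ N ∧ N2 ≤ N := ⟨max N1 N2, le_max_left _ _, le_max_right _ _⟩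
  have hz : ∀ i, N ≤ i → toggleSum mu ka i = 0 := fun i hi => by
    unfold toggleSum
    rw [h1 i (by omega), h1 (i + 1) (by omega), h2 (i + 1) (by omega)]
    simp
  rw [← sum_range_eq_degree (la := rho) (N := N) (fun i hi => by
      have := h i; have := hz i hi; omega),
    ← sum_range_eq_degree (la := nu) (N := N + 1) (fun i hi => by
      obtain ⟨k, rfl⟩ : ∃ k, i = k + 1 := ⟨i - 1, by omega⟩
      have := h k; have := hz k (by omega); omega),
    ← sum_range_eq_degree (la := mu) (N := N) (fun i hi => h1 i (by omega)),
    ← sum_range_eq_degree (la := ka) (N := N) (fun i hi => h2 i (by omega)),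
    Finset.sum_range_succ', ← add_assoc, ← Finset.sum_add_distrib, ← Finset.sum_add_distrib, h0,
    Finset.sum_congr rfl fun i _ => h i]
  unfold toggleSum
  rw [Finset.sum_add_distrib, add_assoc, ← add_assoc _ _ j,
    ← Finset.sum_range_succ' (fun i => max (mu i) (ka i)) N, Finset.sum_range_succ,
    h1 N (by omega), h2 N (by omega), max_self, add_zero, ← add_assoc, ← Finset.sum_add_distrib]
  simp only [min_add_max]

/-- Commutation of adding and removing horizontal strips. -/
theorem sum_stripsAbove_stripsBelow {R : Type*} [CommRing R] (mu : ℕ →₀ ℕ) (r : ℕ) (y : R)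
    (f : (ℕ →₀ ℕ) → R) :
    ∑ nu ∈ stripsAbove mu r, ∑ ka ∈ stripsBelow nu, y ^ (nu.degree - ka.degree) * f ka =
      ∑ j ∈ range (r + 1), ∑ rho ∈ stripsBelow mu, ∑ ka ∈ stripsAbove rho (r - j),
        y ^ (mu.degree - rho.degree + j) * f ka := by
  -- Row `i + 1` of a shape above `mu` and `ka` and row `i` of a shape below them range over the
  -- same interval, from `max (mu (i + 1)) (ka (i + 1))` to `min (mu i) (ka i)`. Reflecting this
  -- interval gives the bijection; row 0 above is unbounded, and its excess over the maximum is
  -- recorded as `j`.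
  have hdown : ∀ {ka nu : ℕ →₀ ℕ}, IsStrip mu nu → IsStrip ka nu →
      (∀ i, toggleDown mu ka nu i + nu (i + 1) = toggleSum mu ka i) ∧
      nu 0 = max (mu 0) (ka 0) + (nu 0 - max (mu 0) (ka 0)) ∧
      IsStrip (toggleDown mu ka nu) mu ∧ IsStrip (toggleDown mu ka nu) ka := by
    intro ka nu h1 h2
    refine ⟨fun i => ?_, ?_, ⟨fun i => ?_, fun i => ?_⟩, fun i => ?_, fun i => ?_⟩
    · have := h1.2 i; have := h2.2 i
      rw [toggleDown_apply, toggleSum]; omega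
    · have := h1.1 0; have := h2.1 0
      omega
    all_goals
      have := h1.1 (i + 1); have := h2.1 (i + 1)
      have := h1.2 i; have := h2.2 i
      rw [toggleDown_apply, toggleSum]
      omega
  have hup : ∀ {ka rho : ℕ →₀ ℕ} (j : ℕ), IsStrip rho mu → IsStrip rho ka →
      (∀ i, rho i + toggleUp mu ka rho j (i + 1) = toggleSum mu ka i) ∧
      IsStrip mu (toggleUp mu ka rho j) ∧ IsStrip ka (toggleUp mu ka rho j) := by
    intro ka rho j h1 h2
    refine ⟨fun i => ?_, ⟨fun i => ?_, fun i => ?_⟩, fun i => ?_, fun i => ?_⟩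
    · have := h1.1 i; have := h2.1 i
      rw [toggleUp_succ, toggleSum]; omega
    · cases i with
      | zero => rw [toggleUp_zero]; omega
      | succ i =>
        have := h1.1 i; have := h2.1 i
        rw [toggleUp_succ, toggleSum]; omega
    · have := h1.2 i; have := h2.2 i
      have := h1.1 i; have := h2.1 i
      rw [toggleUp_succ, toggleSum]; omega
    · cases i with
      | zero => rw [toggleUp_zero]; omega
      | succ i =>
        have := h1.1 i; have := h2.1 i
        rw [toggleUp_succ, toggleSum]; omega
    · have := h1.2 i; have := h2.2 i
      have := h1.1 i; have := h2.1 i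
      rw [toggleUp_succ, toggleSum]; omega
  simp only [Finset.sum_sigma']
  refine Finset.sum_bij'
    (fun a _ => ⟨a.1 0 - max (mu 0) (a.2 0), toggleDown mu a.2 a.1, a.2⟩)
    (fun b _ => ⟨toggleUp mu b.2.2 b.2.1 b.1, b.2.2⟩) ?_ ?_ ?_ ?_ ?_
  · rintro ⟨nu, ka⟩ h
    simp only [mem_sigma, mem_stripsAbove, mem_stripsBelow] at h
    obtain ⟨⟨h1, h2⟩, h3⟩ := h
    obtain ⟨h4, h5, h6, h7⟩ := hdown h1 h3
    have h8 := degree_toggle h4 h5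
    have := h7.degree_le
    simp only [mem_sigma, mem_stripsAbove, mem_stripsBelow, mem_range]
    exact ⟨by omega, h6, h7, by omega⟩
  · rintro ⟨j, rho, ka⟩ h
    simp only [mem_sigma, mem_stripsAbove, mem_stripsBelow, mem_range] at h
    obtain ⟨h1, h2, h3, h4⟩ := h
    obtain ⟨h5, h6, h7⟩ := hup j h2 h3
    have h8 := degree_toggle h5 (toggleUp_zero _ _ _ _)
    simp only [mem_sigma, mem_stripsAbove, mem_stripsBelow]
    exact ⟨⟨h6, by omega⟩, h7⟩
  · rintro ⟨nu, ka⟩ h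
    simp only [mem_sigma, mem_stripsAbove, mem_stripsBelow] at h
    obtain ⟨⟨h1, h2⟩, h3⟩ := h
    obtain ⟨h4, h5, h6, h7⟩ := hdown h1 h3
    simp only [Sigma.mk.injEq, heq_eq_eq, and_true]
    ext i
    cases i with
    | zero => rw [toggleUp_zero]; omega
    | succ i => have := h4 i; rw [toggleUp_succ]; omega
  · rintro ⟨j, rho, ka⟩ h
    simp only [mem_sigma, mem_stripsAbove, mem_stripsBelow, mem_range] at h
    obtain ⟨h1, h2, h3, h4⟩ := h
    obtain ⟨h5, h6, h7⟩ := hup j h2 h3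
    simp only [Sigma.mk.injEq, heq_eq_eq, and_true]
    refine ⟨by rw [toggleUp_zero]; omega, ?_⟩
    ext i
    have := h5 i
    rw [toggleDown_apply]
    omega
  · rintro ⟨nu, ka⟩ h
    simp only [mem_sigma, mem_stripsAbove, mem_stripsBelow] at h
    obtain ⟨⟨h1, h2⟩, h3⟩ := h
    obtain ⟨h4, h5, h6, h7⟩ := hdown h1 h3
    have h8 := degree_toggle h4 h5
    have := h6.degree_le
    have := h3.degree_le
    congr 2
    simp only
    omega

/-! ### Schur polynomials, the Pieri rule and the ribbon expansion -/

section SchurPolynomials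

variable {R : Type*} [CommRing R]

open Classical in
/-- The Schur polynomial in the first `N` variables, by the branching rule. -/
noncomputable def schurPoly (x : ℕ → R) : ℕ → (ℕ →₀ ℕ) → R
  | 0, la => if la = 0 then 1 else 0
  | N + 1, la => ∑ ka ∈ stripsBelow la, x N ^ (la.degree - ka.degree) * schurPoly x N ka

/-- The complete homogeneous symmetric polynomial of degree `r` in the first `N` variables. -/
noncomputable def completePoly (x : ℕ → R) (N r : ℕ) : R :=
  PowerSeries.coeff r (∏ i ∈ range N, PowerSeries.mk fun j => x i ^ j)

theorem completePoly_succ (x : ℕ → R) (N r : ℕ) :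
    completePoly x (N + 1) r = ∑ j ∈ range (r + 1), completePoly x N (r - j) * x N ^ j := by
  unfold completePoly
  rw [Finset.prod_range_succ, mul_comm, PowerSeries.coeff_mul,
    Finset.Nat.sum_antidiagonal_eq_sum_range_succ_mk]
  refine Finset.sum_congr rfl fun j _ => ?_
  rw [PowerSeries.coeff_mk, mul_comm]

theorem completePoly_eq_sum (x : ℕ → R) (N r : ℕ) : completePoly x N r =
    ∑ X ∈ finsuppAntidiag (range N) r, ∏ i ∈ range N, x i ^ X i := by
  unfold completePoly
  rw [PowerSeries.coeff_prod]
  simp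

/-- Each branching step removes at most one row, so `N` steps cannot reach the empty shape from more
than `N` rows. -/
theorem schurPoly_eq_zero (x : ℕ → R) {N i : ℕ} {la : ℕ →₀ ℕ} (hi : N ≤ i) (h : la i ≠ 0) :
    schurPoly x N la = 0 := by
  induction N generalizing i la with
  | zero =>
    rw [schurPoly, if_neg]
    rintro rfl
    exact h rfl
  | succ N ih =>
    obtain ⟨k, rfl⟩ : ∃ k, i = k + 1 := ⟨i - 1, by omega⟩
    refine Finset.sum_eq_zero fun ka hka => ?_
    rw [mem_stripsBelow] at hka
    have := hka.2 k
    rw [ih (i := k) (by omega) (by omega), mul_zero]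

/-- The Pieri rule. -/
theorem sum_stripsAbove_schurPoly (x : ℕ → R) (N r : ℕ) (mu : ℕ →₀ ℕ) (hmu : Antitone mu) :
    ∑ nu ∈ stripsAbove mu r, schurPoly x N nu = completePoly x N r * schurPoly x N mu := by
  induction N generalizing mu r with
  | zero =>
    simp only [schurPoly]
    rw [Finset.sum_ite_eq']
    unfold completePoly
    rw [Finset.range_zero, Finset.prod_empty, PowerSeries.coeff_one, mul_ite, mul_one, mul_zero,
      ← ite_and]
    refine if_congr ?_ rfl rfl
    rw [mem_stripsAbove, map_zero]
    constructor
    · rintro ⟨h1, h2⟩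
      refine ⟨?_, by omega⟩
      ext i
      exact Nat.le_zero.1 (h1.1 i)
    · rintro ⟨rfl, rfl⟩
      exact ⟨⟨fun _ => le_rfl, fun _ => le_rfl⟩, by simp⟩
  | succ N ih =>
    simp only [schurPoly]
    -- After the exchange, the inner sum adds strips above `rho` in `N` variables, where the
    -- induction hypothesis applies; the excess `j` produces the powers of the last variable in the
    -- complete polynomial.
    rw [sum_stripsAbove_stripsBelow, completePoly_succ, Finset.sum_mul_sum]
    refine Finset.sum_congr rfl fun j _ => Finset.sum_congr rfl fun rho hrho => ?_
    rw [← Finset.mul_sum, ih _ _ (mem_stripsBelow.1 hrho).antitone_left, pow_add]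
    ring

theorem schurPoly_eq_zero_of_not_antitone (x : ℕ → R) (N : ℕ) {la : ℕ →₀ ℕ}
    (h : ¬ Antitone la) : schurPoly x N la = 0 := by
  cases N with
  | zero =>
    rw [schurPoly, if_neg]
    rintro rfl
    exact h fun _ _ _ => le_rfl
  | succ N =>
    refine Finset.sum_eq_zero fun ka hka => ?_
    exact absurd (mem_stripsBelow.1 hka).antitone_right h

theorem wordSum_replicate (x : ℕ → R) (N r : ℕ) :
    wordSum x N (List.replicate r false) = completePoly x N (r + 1) := by
  rw [completePoly_eq_sum, ← sum_content_words]
  refine Finset.sum_congr rfl fun w hw => ?_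
  rw [mem_words] at hw
  rw [Finset.prod_list_map_count]
  refine Finset.prod_subset_one_on_sdiff (fun a ha => ?_) (fun a ha => ?_) fun a _ => ?_
  · exact mem_range.2 (hw.2 a (by simpa using ha))
  · rw [mem_sdiff, List.mem_toFinset] at ha
    rw [content_apply, List.count_eq_zero.2 ha.2, pow_zero]
  · rw [content_apply]

theorem wordSum_addBox_replicate (x : ℕ → R) (N r : ℕ) :
    wordSum (addBox R) N (List.replicate r false) (schurPoly x N) =
      wordSum x N (List.replicate r false) • schurPoly x N := by
  classical
  ext ka
  rw [wordSum_addBox_apply, wordSum_replicate, Pi.smul_apply, smul_eq_mul]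
  have h1 : ∀ w ∈ words N (List.replicate r false),
      (if IsLattice ka w then schurPoly x N (ka + content w) else 0) =
        if IsStrip ka (ka + content w) then schurPoly x N (ka + content w) else 0 := by
    intro w hw
    rw [mem_words, hasPattern_replicate] at hw
    refine if_congr (isLattice_iff_isStrip hw.1.1 ?_) rfl rfl
    rintro rfl
    simp at hw
  rw [Finset.sum_congr rfl h1, sum_content_words N r fun X =>
    if IsStrip ka (ka + X) then schurPoly x N (ka + X) else 0]
  by_cases hka : Antitone ka
  · rw [← sum_stripsAbove_schurPoly x N (r + 1) ka hka, ← Finset.sum_filter]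
    -- Letters are below `N`, whereas strips may use any row; the missing strips give shapes with
    -- more than `N` rows, whose Schur polynomials vanish.
    refine Finset.sum_bij_ne_zero (fun X _ _ => ka + X) ?_ ?_ ?_ fun _ _ _ => rfl
    · intro X hX _
      rw [mem_filter, mem_finsuppAntidiag] at hX
      rw [mem_stripsAbove, map_add]
      refine ⟨hX.2, ?_⟩
      rw [← hX.1.1, Finsupp.degree_apply X]
      congr 1
      exact Finset.sum_subset hX.1.2 fun i _ hi => by simpa using hi
    · intro X _ _ Y _ _ h
      exact add_left_cancel h
    · intro nu hnu hne
      rw [mem_stripsAbove] at hnu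
      obtain ⟨X, rfl⟩ := hnu.1.exists_add
      rw [map_add, add_right_inj] at hnu
      have hsub : X.support ⊆ range N := by
        intro i hi
        rw [mem_range]
        by_contra hcon
        refine hne (schurPoly_eq_zero x (not_lt.1 hcon) ?_)
        rw [Finsupp.mem_support_iff] at hi
        simp only [Finsupp.add_apply]
        omega
      refine ⟨X, ?_, hne, rfl⟩
      rw [mem_filter, mem_finsuppAntidiag]
      refine ⟨⟨?_, hsub⟩, hnu.1⟩
      rw [← hnu.2, Finsupp.degree_apply X]
      exact (Finset.sum_subset hsub fun i _ hi => by simpa using hi).symm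
  · rw [schurPoly_eq_zero_of_not_antitone x N hka, mul_zero]
    exact Finset.sum_eq_zero fun X _ => if_neg fun h => hka h.antitone_left

open Classical in
/-- The expansion of a ribbon Schur polynomial in Schur polynomials. -/
theorem wordSum_eq_sum_schurPoly (x : ℕ → R) (N : ℕ) (p : List Bool) :
    wordSum x N p = ∑ w ∈ words N p, if IsLattice 0 w then schurPoly x N (content w) else 0 := by
  have h := congrFun (wordSum_apply_eq_smul (addBox R) x N (schurPoly x N)
    (wordSum_addBox_replicate x N) p) 0
  -- At the empty shape the eigenvalue equation reads off the ribbon polynomial itself.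
  have h0 : schurPoly x N 0 = 1 := by
    clear h
    induction N with
    | zero => rw [schurPoly, if_pos rfl]
    | succ N ih =>
      rw [schurPoly, Finset.sum_eq_single 0]
      · simp [ih]
      · intro ka hka hne
        exact absurd (by ext i; exact Nat.le_zero.1 ((mem_stripsBelow.1 hka).1 i)) hne
      · intro h
        exact absurd (mem_stripsBelow.2 ⟨fun _ => le_rfl, fun _ => le_rfl⟩) h
  rw [wordSum_addBox_apply, Pi.smul_apply, smul_eq_mul, h0, mul_one] at h
  simpa only [zero_add] using h.symm

end SchurPolynomials

/-! ### Schur polynomials as sums over tableaux -/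

/-- The boxes of the shape with row lengths `la`. -/
noncomputable def cellsOf (la : ℕ →₀ ℕ) : Finset (ℕ × ℕ) :=
  (la.support ×ˢ range la.degree).filter fun c => c.2 < la c.1

theorem mem_cellsOf {la : ℕ →₀ ℕ} {c : ℕ × ℕ} : c ∈ cellsOf la ↔ c.2 < la c.1 := by
  rw [cellsOf, mem_filter, and_iff_right_iff_imp, mem_product, mem_range, Finsupp.mem_support_iff]
  intro h
  exact ⟨by omega, h.trans_le (Finsupp.le_degree _ _)⟩

theorem card_cellsOf (la : ℕ →₀ ℕ) : (cellsOf la).card = la.degree := by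
  rw [Finsupp.degree_apply, Finset.card_eq_sum_card_fiberwise (f := Prod.fst) (t := la.support)]
  · refine Finset.sum_congr rfl fun i _ => ?_
    rw [← Finset.card_range (la i)]
    refine Finset.card_bij (fun c _ => c.2) (fun c hc => ?_) (fun c hc d hd h => ?_) fun j hj => ?_
    · rw [mem_filter, mem_cellsOf] at hc
      rw [mem_range, ← hc.2]
      exact hc.1
    · rw [mem_filter] at hc hd
      exact Prod.ext (hc.2.trans hd.2.symm) h
    · exact ⟨(i, j), by simpa [mem_cellsOf] using hj, rfl⟩
  · intro c hc
    rw [mem_coe, mem_cellsOf] at hc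
    rw [mem_coe, Finsupp.mem_support_iff]
    omega

/-- Semistandard fillings of the shape `la` with entries below `N`. -/
structure IsTableau (la : ℕ →₀ ℕ) (N : ℕ) (f : ℕ → ℕ → ℕ) : Prop where
  row_weak : ∀ {i j₁ j₂}, j₁ ≤ j₂ → j₂ < la i → f i j₁ ≤ f i j₂
  col_strict : ∀ {i₁ i₂ j}, i₁ < i₂ → j < la i₂ → f i₁ j < f i₂ j
  zeros : ∀ {i j}, la i ≤ j → f i j = 0
  lt : ∀ {i j}, j < la i → f i j < N

theorem finite_isTableau (la : ℕ →₀ ℕ) (N : ℕ) : {f | IsTableau la N f}.Finite := by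
  refine Set.Finite.of_injOn (f := fun (f : ℕ → ℕ → ℕ) (c : cellsOf la) => f c.1.1 c.1.2)
    (t := Set.pi Set.univ fun _ => Set.Iio N) (fun f hf c _ => ?_) (fun f hf g hg h => ?_)
    (Set.Finite.pi fun _ => Set.finite_Iio N)
  · exact hf.lt (mem_cellsOf.1 c.2)
  · funext i j
    rcases lt_or_ge j (la i) with hj | hj
    · exact congrFun h ⟨(i, j), mem_cellsOf.2 hj⟩
    · rw [hf.zeros hj, hg.zeros hj]

/-- The finite set of semistandard fillings of the shape `la` with entries below `N`. -/
noncomputable def tableaux (la : ℕ →₀ ℕ) (N : ℕ) : Finset (ℕ → ℕ → ℕ) :=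
  (finite_isTableau la N).toFinset

theorem mem_tableaux {la : ℕ →₀ ℕ} {N : ℕ} {f : ℕ → ℕ → ℕ} :
    f ∈ tableaux la N ↔ IsTableau la N f := by
  simp [tableaux]

open Classical in
/-- The shape formed by the boxes with entries below `N`. -/
noncomputable def shapeBelow (la : ℕ →₀ ℕ) (N : ℕ) (f : ℕ → ℕ → ℕ) : ℕ →₀ ℕ :=
  truncate (la.support.sup id + 1) fun i =>
    Nat.find (p := fun j => ¬ (j < la i ∧ f i j < N)) ⟨la i, fun h => lt_irrefl _ h.1⟩

theorem lt_shapeBelow {la : ℕ →₀ ℕ} {N M : ℕ} {f : ℕ → ℕ → ℕ} (hf : IsTableau la M f) {i j : ℕ} :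
    j < shapeBelow la N f i ↔ j < la i ∧ f i j < N := by
  classical
  rw [shapeBelow, truncate_apply, Nat.lt_find_iff]
  · constructor
    · intro h
      exact not_not.1 (h j le_rfl)
    · rintro ⟨h1, h2⟩ k hk
      exact not_not.2 ⟨by omega, (hf.row_weak hk h1).trans_lt h2⟩
  · intro i hi
    rw [Nat.find_eq_zero]
    rintro ⟨h, -⟩
    rw [eq_zero_of_support_sup_lt (by omega)] at h
    exact absurd h (Nat.not_lt_zero _)

theorem isStrip_shapeBelow {la : ℕ →₀ ℕ} {N : ℕ} {f : ℕ → ℕ → ℕ} (hla : Antitone la)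
    (hf : IsTableau la (N + 1) f) : IsStrip (shapeBelow la N f) la := by
  refine ⟨fun i => ?_, fun i => ?_⟩
  · by_contra h
    exact lt_irrefl _ ((lt_shapeBelow hf).1 (not_le.1 h)).1
  · by_contra h
    have h1 := not_le.1 h
    have h2 := hf.col_strict (show i < i + 1 by omega) h1
    have h3 := hf.lt h1
    exact lt_irrefl _ ((lt_shapeBelow hf).2 ⟨h1.trans_le (hla (Nat.le_succ i)), by omega⟩)

theorem isTableau_restrict {la ka : ℕ →₀ ℕ} {N : ℕ} {f : ℕ → ℕ → ℕ} (hka : Antitone ka)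
    (hf : IsTableau la (N + 1) f) (hk : ∀ {i j}, j < ka i ↔ j < la i ∧ f i j < N) :
    IsTableau ka N (fun i j => if j < ka i then f i j else 0) where
  row_weak hj h2 := by
    rw [if_pos h2, if_pos (hj.trans_lt h2)]
    exact hf.row_weak hj (hk.1 h2).1
  col_strict hi hj := by
    rw [if_pos hj, if_pos (hj.trans_le (hka hi.le))]
    exact hf.col_strict hi (hk.1 hj).1
  zeros hj := if_neg (not_lt.2 hj)
  lt hj := by
    rw [if_pos hj]
    exact (hk.1 hj).2

theorem isTableau_extend {la ka : ℕ →₀ ℕ} {N : ℕ} {g : ℕ → ℕ → ℕ} (hs : IsStrip ka la)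
    (hg : IsTableau ka N g) : IsTableau la (N + 1)
      (fun i j => if j < ka i then g i j else if j < la i then N else 0) where
  row_weak {i j₁ j₂} hj h2 := by
    rw [if_pos h2, if_pos (hj.trans_lt h2)]
    split_ifs with h3 h4 h4
    · exact hg.row_weak hj h4
    · exact (hg.lt h3).le
    · omega
    · exact le_rfl
  col_strict {i₁ i₂ j} hi hj := by
    have h5 : j < ka i₁ := by
      obtain ⟨k, rfl⟩ : ∃ k, i₂ = k + 1 := ⟨i₂ - 1, by omega⟩
      exact hj.trans_le ((hs.2 k).trans (hs.antitone_left (by omega)))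
    rw [if_pos h5, if_pos hj]
    split_ifs with h4
    · exact hg.col_strict hi h4
    · exact hg.lt h5
  zeros {i j} hj := by
    have := hs.1 i
    rw [if_neg (by omega), if_neg (by omega)]
  lt {i j} hj := by
    rw [if_pos hj]
    split_ifs with h4
    · have := hg.lt h4
      omega
    · omega

theorem shapeBelow_extend {la ka : ℕ →₀ ℕ} {N : ℕ} {g : ℕ → ℕ → ℕ} (hs : IsStrip ka la)
    (hg : IsTableau ka N g) : shapeBelow la N
      (fun i j => if j < ka i then g i j else if j < la i then N else 0) = ka := by
  ext i
  refine eq_of_forall_lt_iff fun j => ?_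
  rw [lt_shapeBelow (isTableau_extend hs hg)]
  constructor
  · rintro ⟨h1, h2⟩
    by_contra h3
    rw [if_neg h3, if_pos h1] at h2
    exact lt_irrefl _ h2
  · intro h
    rw [if_pos h]
    exact ⟨h.trans_le (hs.1 i), hg.lt h⟩

/-- The branching rule for semistandard fillings. -/
theorem sum_tableaux_succ {R : Type*} [CommRing R] (x : ℕ → R) (N : ℕ) {la : ℕ →₀ ℕ}
    (hla : Antitone la) :
    ∑ f ∈ tableaux la (N + 1), ∏ c ∈ cellsOf la, x (f c.1 c.2) =
      ∑ ka ∈ stripsBelow la, x N ^ (la.degree - ka.degree) *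
        ∑ g ∈ tableaux ka N, ∏ c ∈ cellsOf ka, x (g c.1 c.2) := by
  simp only [Finset.mul_sum]
  rw [Finset.sum_sigma']
  symm
  refine Finset.sum_bij'
    (fun a _ => fun i j => if j < a.1 i then a.2 i j else if j < la i then N else 0)
    (fun f _ => ⟨shapeBelow la N f, fun i j => if j < shapeBelow la N f i then f i j else 0⟩)
    ?_ ?_ ?_ ?_ ?_
  · rintro ⟨ka, g⟩ h
    rw [mem_sigma, mem_stripsBelow, mem_tableaux] at h
    exact mem_tableaux.2 (isTableau_extend h.1 h.2)
  · intro f hf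
    rw [mem_tableaux] at hf
    rw [mem_sigma, mem_stripsBelow, mem_tableaux]
    have hs := isStrip_shapeBelow hla hf
    exact ⟨hs, isTableau_restrict hs.antitone_left hf (lt_shapeBelow hf)⟩
  · rintro ⟨ka, g⟩ h
    rw [mem_sigma, mem_stripsBelow, mem_tableaux] at h
    have h1 := shapeBelow_extend h.1 h.2
    simp only at h1 ⊢
    rw [h1, Sigma.mk.injEq]
    refine ⟨rfl, heq_of_eq ?_⟩
    funext i j
    split_ifs with h2
    · rfl
    · exact (h.2.zeros (not_lt.1 h2)).symm
  · intro f hf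
    rw [mem_tableaux] at hf
    funext i j
    simp only
    split_ifs with h1 h2
    · rfl
    · have := hf.lt h2
      rw [lt_shapeBelow hf] at h1
      omega
    · exact (hf.zeros (not_lt.1 h2)).symm
  · rintro ⟨ka, g⟩ h
    rw [mem_sigma, mem_stripsBelow, mem_tableaux] at h
    obtain ⟨hs, hg⟩ := h
    simp only at hs hg ⊢
    have hsub : cellsOf ka ⊆ cellsOf la := fun c hc => by
      rw [mem_cellsOf] at hc ⊢
      exact hc.trans_le (hs.1 _)
    rw [← Finset.prod_sdiff hsub, ← card_cellsOf, ← card_cellsOf,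
      ← Finset.card_sdiff_of_subset hsub, ← Finset.prod_const]
    congr 1
    · refine Finset.prod_congr rfl fun c hc => ?_
      rw [mem_sdiff, mem_cellsOf, mem_cellsOf] at hc
      rw [if_neg hc.2, if_pos hc.1]
    · refine Finset.prod_congr rfl fun c hc => ?_
      rw [mem_cellsOf] at hc
      rw [if_pos hc]

theorem schurPoly_eq_sum_tableaux {R : Type*} [CommRing R] (x : ℕ → R) (N : ℕ) {la : ℕ →₀ ℕ}
    (hla : Antitone la) :
    schurPoly x N la = ∑ f ∈ tableaux la N, ∏ c ∈ cellsOf la, x (f c.1 c.2) := by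
  induction N generalizing la with
  | zero =>
    rw [schurPoly]
    split_ifs with h
    · subst h
      have h1 : tableaux 0 0 = {fun _ _ => 0} := by
        ext f
        rw [mem_tableaux, mem_singleton]
        constructor
        · intro h
          funext i j
          exact h.zeros (by simp)
        · rintro rfl
          exact ⟨by simp, by simp, by simp, by simp⟩
      have h2 : cellsOf 0 = ∅ := by
        ext c
        simp [mem_cellsOf]
      rw [h1, h2]
      simp
    · symm
      refine Finset.sum_eq_zero fun f hf => ?_
      rw [mem_tableaux] at hf
      obtain ⟨i, hi⟩ := Finsupp.ne_iff.1 h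
      exact absurd (hf.lt (i := i) (j := 0) (Nat.pos_of_ne_zero hi)) (Nat.not_lt_zero _)
  | succ N ih =>
    rw [schurPoly, sum_tableaux_succ x N hla]
    refine Finset.sum_congr rfl fun ka hka => ?_
    rw [ih (mem_stripsBelow.1 hka).antitone_left]

theorem prod_X_eq_monomial {ι : Type*} (s : Finset ι) (f : ι → ℕ) :
    ∏ c ∈ s, (MvPolynomial.X (f c) : MvPolynomial ℕ ℚ) =
      MvPolynomial.monomial (∑ c ∈ s, Finsupp.single (f c) 1) 1 := by
  classical
  induction s using Finset.induction_on with
  | empty => simp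
  | insert a s ha ih =>
    rw [Finset.prod_insert ha, Finset.sum_insert ha, ih, MvPolynomial.X,
      MvPolynomial.monomial_mul, one_mul]

/-- The row lengths of a Young diagram. -/
noncomputable def rowsOf (nu : YoungDiagram) : ℕ →₀ ℕ := truncate (nu.colLen 0) nu.rowLen

theorem rowsOf_apply (nu : YoungDiagram) (i : ℕ) : rowsOf nu i = nu.rowLen i := by
  refine truncate_apply (fun i hi => ?_) i
  by_contra h
  have h1 : (i, 0) ∈ nu := YoungDiagram.mem_iff_lt_rowLen.2 (Nat.pos_of_ne_zero h)
  rw [YoungDiagram.mem_iff_lt_colLen] at h1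
  omega

theorem antitone_rowsOf (nu : YoungDiagram) : Antitone (rowsOf nu) := fun i j h => by
  rw [rowsOf_apply, rowsOf_apply]
  exact nu.rowLen_anti i j h

theorem cellsOf_rowsOf (nu : YoungDiagram) : cellsOf (rowsOf nu) = nu.cells := by
  ext ⟨i, j⟩
  rw [mem_cellsOf, rowsOf_apply, YoungDiagram.mem_cells, YoungDiagram.mem_iff_lt_rowLen]

theorem degree_rowsOf (nu : YoungDiagram) : (rowsOf nu).degree = nu.card := by
  rw [← card_cellsOf, cellsOf_rowsOf]

theorem rowsOf_injective : Function.Injective rowsOf := fun nu mu h => by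
  rw [YoungDiagram.ext_iff, ← cellsOf_rowsOf, h, cellsOf_rowsOf]

theorem exists_rowsOf_eq {la : ℕ →₀ ℕ} (h : Antitone la) : ∃ nu, rowsOf nu = la := by
  refine ⟨⟨cellsOf la, ?_⟩, ?_⟩
  · rintro ⟨i, j⟩ ⟨i', j'⟩ hle hc
    rw [mem_coe, mem_cellsOf] at hc ⊢
    exact hle.2.trans_lt (hc.trans_le (h hle.1))
  · ext i
    refine eq_of_forall_lt_iff fun j => ?_
    rw [rowsOf_apply, ← YoungDiagram.mem_iff_lt_rowLen, ← YoungDiagram.mem_cells]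
    exact mem_cellsOf

theorem fillingContent_apply (D : Finset (ℕ × ℕ)) (T : ℕ → ℕ → ℕ) (a : ℕ) :
    fillingContent D T a = (D.filter fun c => T c.1 c.2 = a).card := by
  rw [fillingContent, Finsupp.finsetSum_apply, Finset.card_filter]
  exact Finset.sum_congr rfl fun c _ => Finsupp.single_apply

theorem lt_of_fillingContent {D : Finset (ℕ × ℕ)} {T : ℕ → ℕ → ℕ} {m : ℕ →₀ ℕ} {N : ℕ}
    (hm : m.support ⊆ range N) (h : fillingContent D T = m) {c : ℕ × ℕ} (hc : c ∈ D) :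
    T c.1 c.2 < N := by
  rw [← mem_range]
  refine hm ?_
  rw [← h, Finsupp.mem_support_iff, fillingContent_apply, ← Nat.pos_iff_ne_zero, Finset.card_pos]
  exact ⟨c, mem_filter.2 ⟨hc, rfl⟩⟩

theorem isTableau_entry {nu : YoungDiagram} (T : SemistandardYoungTableau nu) {N : ℕ}
    (hN : ∀ c ∈ nu.cells, T c.1 c.2 < N) : IsTableau (rowsOf nu) N T := by
  have hc : ∀ {i j}, j < rowsOf nu i → (i, j) ∈ nu := fun {i j} h => by
    rwa [YoungDiagram.mem_iff_lt_rowLen, ← rowsOf_apply]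
  refine ⟨fun hj h => T.row_weak_of_le hj (hc h), fun hi h => T.col_strict hi (hc h),
    fun {i j} h => T.zeros fun h' => ?_, fun {i j} h => hN (i, j) (hc h)⟩
  rw [YoungDiagram.mem_iff_lt_rowLen, ← rowsOf_apply] at h'
  omega

/-- A tableau of content `m` only uses letters in the support of `m`, so finitely many variables
suffice to see this coefficient. -/
theorem coeff_schurPoly (nu : YoungDiagram) {N : ℕ} {m : ℕ →₀ ℕ} (hm : m.support ⊆ range N) :
    (schurPoly (MvPolynomial.X : ℕ → MvPolynomial ℕ ℚ) N (rowsOf nu)).coeff m =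
      schurFunction nu m := by
  classical
  rw [schurPoly_eq_sum_tableaux _ _ (antitone_rowsOf nu), MvPolynomial.coeff_sum, schurFunction]
  simp only [prod_X_eq_monomial, MvPolynomial.coeff_monomial]
  rw [Finset.sum_boole, ← Nat.card_eq_finsetCard]
  congr 1
  rw [cellsOf_rowsOf]
  refine Nat.card_congr ⟨fun f => ⟨⟨f.1, fun {i j₁ j₂} hj hc => ?_, fun {i₁ i₂ j} hi hc => ?_,
    fun {i j} hc => ?_⟩, ?_⟩, fun T => ⟨T.1.1, ?_⟩, fun f => rfl, fun T => rfl⟩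
  · have hf := mem_tableaux.1 (mem_filter.1 f.2).1
    rw [← YoungDiagram.mem_cells, ← cellsOf_rowsOf, mem_cellsOf] at hc
    exact hf.row_weak hj.le hc
  · have hf := mem_tableaux.1 (mem_filter.1 f.2).1
    rw [← YoungDiagram.mem_cells, ← cellsOf_rowsOf, mem_cellsOf] at hc
    exact hf.col_strict hi hc
  · have hf := mem_tableaux.1 (mem_filter.1 f.2).1
    rw [← YoungDiagram.mem_cells, ← cellsOf_rowsOf, mem_cellsOf] at hc
    exact hf.zeros (not_lt.1 hc)
  · exact (mem_filter.1 f.2).2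
  · obtain ⟨T, hT⟩ := T
    exact mem_filter.2 ⟨mem_tableaux.2 (isTableau_entry T fun c hc =>
      lt_of_fillingContent hm hT hc), hT⟩

/-! ### Chains of strips and lattice words -/

/-- Row `i + 1` of `la` is at most row `i` of `ka`, so `la` has no more boxes after its first `j +
1` rows than `ka` has after its first `j`. Comparing with the total sizes gives the claim. -/
theorem sum_range_add_le_of_isStrip {ka la : ℕ →₀ ℕ} {r : ℕ} (h : IsStrip ka la)
    (hd : la.degree = ka.degree + r) (j : ℕ) :
    ∑ i ∈ range j, ka i + r ≤ ∑ i ∈ range (j + 1), la i := by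
  obtain ⟨N, hN⟩ := exists_forall_ge_eq_zero la
  have h1 : ∀ d, ∑ i ∈ range (j + d + 1), la i + ∑ i ∈ range j, ka i ≤
      ∑ i ∈ range (j + 1), la i + ∑ i ∈ range (j + d), ka i := by
    intro d
    induction d with
    | zero => simp
    | succ d ih =>
      have := h.2 (j + d)
      have h2 := Finset.sum_range_succ la (j + d + 1)
      have h3 := Finset.sum_range_succ ka (j + d)
      rw [show j + (d + 1) + 1 = j + d + 1 + 1 by omega, show j + (d + 1) = j + d + 1 by omega]
      omega
  have h2 := h1 N
  have h3 := sum_range_eq_degree (la := la) (N := j + N + 1) fun i hi => hN i (by omega)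
  have h4 := sum_range_eq_degree (la := ka) (N := j + N) fun i hi =>
    Nat.le_zero.1 ((h.1 i).trans (hN i (by omega)).le)
  omega

/-- A chosen part `r` is paid for by the one additional row that becomes available with the strip of
size `r`; a part not chosen only enlarges the shape. -/
theorem HasDescentChain.domParts {b : List ℕ} {la : ℕ →₀ ℕ} {u : ℕ}
    (h : HasDescentChain b la u) : DomParts b la := by
  induction h with
  | single r hr =>
    intro s hs
    rw [Multiset.coe_singleton, Multiset.le_singleton] at hs
    rcases hs with rfl | rfl <;> simp
  | @cons b ka la t i r u h hs hd hti hi hu ih =>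
    intro s hsb
    rw [← Multiset.cons_coe] at hsb
    by_cases hr : r ∈ s
    · obtain ⟨s', rfl⟩ := Multiset.exists_cons_of_mem hr
      have h1 := ih s' ((Multiset.cons_le_cons_iff r).1 hsb)
      have h2 := sum_range_add_le_of_isStrip hs hd (Multiset.card s')
      rw [Multiset.sum_cons, Multiset.card_cons]
      omega
    · exact (ih s ((Multiset.le_cons_of_notMem hr).1 hsb)).trans
        (Finset.sum_le_sum fun i _ => hs.1 i)

/-- The ascent pattern of the ribbon with row lengths `b`, the last row coming first. -/
def patternRev : List ℕ → List Bool
  | [] => []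
  | [r] => List.replicate (r - 1) false
  | r :: r' :: b => patternRev (r' :: b) ++ true :: List.replicate (r - 1) false

theorem patternRev_cons {r : ℕ} {b : List ℕ} (hb : b ≠ []) :
    patternRev (r :: b) = patternRev b ++ true :: List.replicate (r - 1) false := by
  cases b with
  | nil => exact absurd rfl hb
  | cons r' b => rfl

theorem hasPattern_append {p q : List Bool} {c : Bool} {w : List ℕ} :
    HasPattern (p ++ c :: q) w ↔ ∃ v a a' v', w = (v ++ [a]) ++ (a' :: v') ∧
      HasPattern p (v ++ [a]) ∧ (a < a' ↔ c = true) ∧ HasPattern q (a' :: v') := by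
  induction p generalizing w with
  | nil =>
    rw [List.nil_append, HasPattern]
    constructor
    · rintro ⟨a, a', v', rfl, h1, h2⟩
      exact ⟨[], a, a', v', rfl, ⟨a, rfl⟩, h1, h2⟩
    · rintro ⟨v, a, a', v', rfl, ⟨b, hb⟩, h1, h2⟩
      have hv : v = [] := by
        have := congrArg List.length hb
        simp at this
        exact this
      subst hv
      exact ⟨a, a', v', rfl, h1, h2⟩
  | cons d p ih =>
    rw [List.cons_append, HasPattern]
    constructor
    · rintro ⟨x, y, w', rfl, h1, h2⟩
      obtain ⟨v, a, a', v', hw, h3, h4, h5⟩ := ih.1 h2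
      refine ⟨x :: v, a, a', v', by rw [hw]; rfl, ?_, h4, h5⟩
      cases v with
      | nil =>
        simp only [List.nil_append, List.cons_append, List.cons.injEq] at hw
        rw [hw.1] at h1
        exact ⟨x, a, [], rfl, h1, h3⟩
      | cons z v =>
        simp only [List.cons_append, List.cons.injEq] at hw
        rw [hw.1] at h1
        exact ⟨x, z, v ++ [a], rfl, h1, h3⟩
    · rintro ⟨v, a, a', v', rfl, ⟨x, y, w', hw, h1, h2⟩, h4, h5⟩
      cases v with
      | nil => simp at hw
      | cons z v =>
        simp only [List.cons_append, List.cons.injEq] at hw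
        obtain ⟨rfl, hw⟩ := hw
        refine ⟨z, y, w' ++ (a' :: v'), ?_, h1, ?_⟩
        · rw [List.cons_append, List.cons_append, hw, List.cons_append]
        · rw [← hw] at h2
          rw [← List.cons_append, ← hw]
          exact ih.2 ⟨v, a, a', v', rfl, h2, h4, h5⟩

theorem isStrip_zero {r : ℕ} : IsStrip 0 (Finsupp.single 0 r) :=
  ⟨fun _ => Nat.zero_le _, fun i => by simp⟩

theorem eq_single_of_isStrip_zero {la : ℕ →₀ ℕ} (h : IsStrip 0 la) :
    la = Finsupp.single 0 la.degree := by
  have h1 : la = Finsupp.single 0 (la 0) := by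
    ext i
    cases i with
    | zero => simp
    | succ i =>
      rw [Finsupp.single_eq_of_ne (by omega)]
      exact Nat.le_zero.1 (h.2 i)
  conv_rhs => rw [h1, Finsupp.degree_single]
  exact h1

/-- A lattice word with the pattern of a ribbon gives a chain of strips. -/
theorem hasDescentChain_of_word {b : List ℕ} (hb : b ≠ []) (hpos : ∀ r ∈ b, 0 < r) {v : List ℕ}
    {a : ℕ} (hp : HasPattern (patternRev b) (v ++ [a])) (hl : IsLattice 0 (v ++ [a])) :
    HasDescentChain b (content (v ++ [a])) a := by
  induction b generalizing v a with
  | nil => exact absurd rfl hb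
  | cons r b ih =>
    have hr := hpos r (by simp)
    rcases eq_or_ne b [] with rfl | hb'
    · rw [patternRev, hasPattern_replicate] at hp
      rw [isLattice_iff_isStrip hp.1 (by simp), zero_add] at hl
      have h1 := eq_single_of_isStrip_zero hl
      rw [degree_content, hp.2, Nat.sub_add_cancel hr] at h1
      have ha : a = 0 := by
        by_contra ha
        have h2 : content (v ++ [a]) a = 0 := by
          rw [h1, Finsupp.single_eq_of_ne ha]
        rw [content_apply, List.count_eq_zero] at h2
        exact h2 (by simp)
      rw [h1, ha]
      exact .single r hr
    · rw [patternRev_cons hb', hasPattern_append] at hp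
      obtain ⟨v₁, a₁, a', v', hw, h1, h2, h3⟩ := hp
      rw [hw] at hl ⊢
      rw [isLattice_append, zero_add] at hl
      rw [hasPattern_replicate] at h3
      have hs := (isLattice_iff_isStrip h3.1 (by simp)).1 hl.2
      have hc := ih hb' (fun r hr => hpos r (by simp [hr])) h1 hl.1
      have hmem : ∀ y ∈ a' :: v', content (v₁ ++ [a₁]) y <
          (content (v₁ ++ [a₁]) + content (a' :: v')) y := fun y hy => by
        rw [Finsupp.add_apply, content_apply (a' :: v')]
        have := List.count_pos_iff.2 hy
        omega
      rw [content_append]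
      refine .cons hc hs ?_ (h2.2 rfl) (hmem a' (by simp)) (hmem a ?_)
      · rw [map_add, degree_content (a' :: v'), h3.2, Nat.sub_add_cancel hr]
      · have h4 := congrArg List.getLast? hw
        rw [List.getLast?_append_of_ne_nil _ (by simp), List.getLast?_append_of_ne_nil _ (by simp)]
          at h4
        exact List.mem_of_getLast? h4.symm

/-- The weakly decreasing word with given multiplicities. -/
theorem exists_decreasing_word (X : ℕ →₀ ℕ) :
    ∃ w : List ℕ, w.Pairwise (· ≥ ·) ∧ content w = X := by
  refine ⟨(Finsupp.toMultiset X).sort (· ≥ ·), Multiset.pairwise_sort _ _, ?_⟩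
  ext a
  rw [content_apply, ← Multiset.coe_count, Multiset.sort_eq, Finsupp.count_toMultiset]

theorem HasDescentChain.exists_word {b : List ℕ} {la : ℕ →₀ ℕ} {u : ℕ}
    (h : HasDescentChain b la u) : ∃ v a, HasPattern (patternRev b) (v ++ [a]) ∧
      IsLattice 0 (v ++ [a]) ∧ content (v ++ [a]) = la ∧ a ≤ u := by
  induction h with
  | single r hr =>
    have h1 : List.replicate (r - 1) 0 ++ [0] = List.replicate r 0 := by
      rw [← List.replicate_succ', Nat.sub_add_cancel hr]
    have h2 : content (List.replicate r 0) = Finsupp.single 0 r := by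
      ext a
      rw [content_apply, List.count_replicate, Finsupp.single_apply]
      simp
    have h3 : (List.replicate r 0).Pairwise (· ≥ ·) := by
      rw [List.pairwise_replicate]
      exact Or.inr le_rfl
    refine ⟨List.replicate (r - 1) 0, 0, ?_, ?_, ?_, le_rfl⟩
    · rw [h1, patternRev, hasPattern_replicate]
      exact ⟨h3, by rw [List.length_replicate, Nat.sub_add_cancel hr]⟩
    · rw [h1, isLattice_iff_isStrip h3 (by simp; omega), h2, zero_add]
      exact isStrip_zero
    · rw [h1, h2]
  | @cons b ka la t i r u h hs hd hti hi hu ih =>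
    obtain ⟨v, a, h1, h2, h3, h4⟩ := ih
    obtain ⟨X, rfl⟩ := hs.exists_add
    obtain ⟨w, hw, rfl⟩ := exists_decreasing_word X
    simp only [Finsupp.add_apply] at hi hu
    rw [map_add, add_right_inj, degree_content] at hd
    have hb : b ≠ [] := by
      rintro rfl
      cases h
    have hmem : ∀ y, ka y < ka y + content w y → y ∈ w := fun y hy => by
      rw [content_apply] at hy
      exact List.count_pos_iff.1 (by omega)
    have hiw := hmem i hi
    have huw := hmem u hu
    have hne : w ≠ [] := List.ne_nil_of_mem hiw
    obtain ⟨a', v', hw1⟩ := List.exists_cons_of_ne_nil hne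
    have hr : 0 < r := by rw [← hd]; exact List.length_pos_iff.2 hne
    -- The first letter of the decreasing word is its lowest row and the last letter its highest, so
    -- the descent `t < i` becomes the ascent `a ≤ t < i ≤ a'` at the junction.
    have hia : i ≤ a' := by
      rw [hw1] at hw hiw
      rcases List.mem_cons.1 hiw with rfl | h5
      · exact le_rfl
      · exact List.rel_of_pairwise_cons hw h5
    have hlast : w.getLast hne ≤ u := by
      have h6 := hw
      rw [← List.dropLast_append_getLast hne] at h6 huw
      rcases List.mem_append.1 huw with h5 | h5
      · exact (List.pairwise_append.1 h6).2.2 u h5 _ (by simp)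
      · rw [List.mem_singleton.1 h5]
    have heq : (v ++ [a] ++ w.dropLast) ++ [w.getLast hne] = (v ++ [a]) ++ w := by
      rw [List.append_assoc, List.dropLast_append_getLast hne]
    refine ⟨v ++ [a] ++ w.dropLast, w.getLast hne, ?_, ?_, ?_, hlast⟩
    · rw [heq, patternRev_cons hb, hasPattern_append]
      refine ⟨v, a, a', v', by rw [hw1], h1, ⟨fun _ => rfl, fun _ => by omega⟩, ?_⟩
      rw [← hw1, hasPattern_replicate]
      exact ⟨hw, by omega⟩
    · rw [heq, isLattice_append, h3, zero_add]
      exact ⟨h2, (isLattice_iff_isStrip hw hne).2 hs⟩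
    · rw [heq, content_append, h3]

/-- The contents of the lattice words with the pattern of a ribbon. -/
theorem exists_lattice_word_iff {b : List ℕ} (hb : b ≠ []) (h2 : ∀ y ∈ b, 2 ≤ y)
    (htri : AllStrictTriangles (b : Multiset ℕ)) {la : ℕ →₀ ℕ} :
    (∃ w, HasPattern (patternRev b) w ∧ IsLattice 0 w ∧ content w = la) ↔
      Antitone la ∧ la.degree = b.sum ∧ DomParts b la ∧ la 0 + b.length ≤ b.sum + 1 := by
  constructor
  · rintro ⟨w, h1, h3, rfl⟩
    have hw : w ≠ [] := by
      rintro rfl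
      cases hp : patternRev b with
      | nil => rw [hp] at h1; obtain ⟨a, h⟩ := h1; cases h
      | cons c p => rw [hp] at h1; obtain ⟨a, a', w', h, -⟩ := h1; cases h
    rw [← List.dropLast_append_getLast hw] at h1 h3 ⊢
    have h4 := hasDescentChain_of_word hb (fun r hr => by have := h2 r hr; omega) h1 h3
    exact ⟨h4.antitone, h4.degree_eq, h4.domParts, h4.zero_row_le⟩
  · rintro ⟨h1, h3, h4, h5⟩
    obtain ⟨u, hu⟩ := hasChains hb h2 htri la h1 h3 h4 h5
    obtain ⟨v, a, h6, h7, h8, -⟩ := hu.exists_word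
    exact ⟨v ++ [a], h6, h7, h8⟩

/-! ### Reading words of ribbon tableaux -/

theorem hasPattern_iff_getD {p : List Bool} {w : List ℕ} : HasPattern p w ↔
    w.length = p.length + 1 ∧ ∀ k, k < p.length →
      (w.getD k 0 < w.getD (k + 1) 0 ↔ p.getD k false = true) := by
  induction p generalizing w with
  | nil => simp [HasPattern, List.length_eq_one_iff]
  | cons c p ih =>
    rw [HasPattern]
    constructor
    · rintro ⟨a, a', w', rfl, h1, h2⟩
      obtain ⟨h3, h4⟩ := ih.1 h2
      refine ⟨by rw [List.length_cons, h3, List.length_cons], fun k hk => ?_⟩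
      cases k with
      | zero => simpa using h1
      | succ k => simpa using h4 k (by simpa using hk)
    · rintro ⟨h1, h2⟩
      match w, h1 with
      | a :: a' :: w', h1 =>
        refine ⟨a, a', w', rfl, by simpa using h2 0 (by simp), ih.2 ⟨by simpa using h1, ?_⟩⟩
        intro k hk
        simpa using h2 (k + 1) (by simpa using hk)

theorem length_patternRev {b : List ℕ} (hb : b ≠ []) (hpos : ∀ r ∈ b, 0 < r) :
    (patternRev b).length + 1 = b.sum := by
  induction b with
  | nil => exact absurd rfl hb
  | cons r b ih =>
    have hr := hpos r (by simp)
    rcases eq_or_ne b [] with rfl | hb'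
    · simp [patternRev]; omega
    · have := ih hb' fun r hr => hpos r (by simp [hr])
      rw [patternRev_cons hb']
      simp only [List.length_append, List.length_cons, List.length_replicate, List.sum_cons]
      omega

theorem sum_drop_le (b : List ℕ) (t : ℕ) : (b.drop t).sum ≤ b.sum := by
  conv_rhs => rw [← List.take_append_drop t b, List.sum_append]
  omega

/-- The last entries of `b` are read first, so an ascent occurs when the letters read so far fill a
proper non-empty suffix of `b`. -/
theorem getD_patternRev {b : List ℕ} (hpos : ∀ r ∈ b, 0 < r) {k : ℕ} (hk : k + 1 < b.sum) :
    (patternRev b).getD k false = true ↔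
      ∃ t, 1 ≤ t ∧ t < b.length ∧ k + 1 = (b.drop t).sum := by
  induction b with
  | nil => simp at hk
  | cons r b ih =>
    have hposb : ∀ r ∈ b, 0 < r := fun r hr => hpos r (by simp [hr])
    have hr := hpos r (by simp)
    rcases eq_or_ne b [] with rfl | hb
    · rw [patternRev]
      constructor
      · intro h
        simp only [List.sum_cons, List.sum_nil] at hk
        rw [List.getD_eq_getElem _ _ (by rw [List.length_replicate]; omega),
          List.getElem_replicate] at h
        cases h
      · rintro ⟨t, h1, h2, -⟩
        simp at h2
        omega
    · rw [patternRev_cons hb]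
      have hlen := length_patternRev hb hposb
      have hbl := List.length_pos_iff.2 hb
      have hshift : (∃ t, 1 ≤ t ∧ t < (r :: b).length ∧ k + 1 = ((r :: b).drop t).sum) ↔
          k + 1 = b.sum ∨ ∃ t, 1 ≤ t ∧ t < b.length ∧ k + 1 = (b.drop t).sum := by
        constructor
        · rintro ⟨t, h1, h2, h3⟩
          obtain ⟨t, rfl⟩ : ∃ s, t = s + 1 := ⟨t - 1, by omega⟩
          rw [List.drop_succ_cons] at h3
          cases t with
          | zero => left; simpa using h3
          | succ t => exact Or.inr ⟨t + 1, by omega, by simpa using h2, h3⟩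
        · rintro (h | ⟨t, h1, h2, h3⟩)
          · exact ⟨1, le_rfl, by simpa using hbl, by simpa using h⟩
          · exact ⟨t + 1, by omega, by simpa using h2, by simpa using h3⟩
      rw [hshift]
      rcases lt_trichotomy k (patternRev b).length with h | h | h
      · rw [List.getD_append _ _ _ _ h, ih hposb (by omega)]
        constructor
        · exact Or.inr
        · rintro (h1 | h1)
          · omega
          · exact h1
      · rw [List.getD_append_right _ _ _ _ (by omega), h, Nat.sub_self]
        simp only [List.getD_cons_zero, true_iff]
        left
        omega
      · rw [List.getD_append_right _ _ _ _ (by omega)]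
        obtain ⟨d, hd⟩ : ∃ d, k - (patternRev b).length = d + 1 :=
          ⟨k - (patternRev b).length - 1, by omega⟩
        rw [hd, List.getD_cons_succ]
        simp only [List.sum_cons] at hk
        rw [List.getD_eq_getElem _ _ (by rw [List.length_replicate]; omega),
          List.getElem_replicate]
        constructor
        · intro h; cases h
        · rintro (h1 | ⟨t, h1, h2, h3⟩)
          · omega
          · have := sum_drop_le b t
            omega

/-- Each of the `i` junctions among the first `i + 1` rows shares one column, so these rows span `i`
columns fewer than they have boxes. -/
theorem sum_take_add_ribbonStart (b : List ℕ) (hpos : ∀ r ∈ b, 0 < r) {i : ℕ}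
    (hi : i < b.length) :
    (b.take (i + 1)).sum + ribbonStart b i = ribbonStart b 0 + b.getD 0 0 + i := by
  induction i with
  | zero =>
    match b, hi with
    | r :: b, _ => simp [add_comm]
  | succ i ih =>
    have h1 := ih (by omega)
    have h2 := ribbonStart_succ hi
    have h3 := hpos _ (List.getElem_mem hi)
    rw [List.take_add_one, List.getElem?_eq_getElem hi, List.sum_append]
    simp only [Option.toList_some, List.sum_singleton]
    omega

/-- The position of a box of a ribbon, when the rows are read from right to left and from top to
bottom. -/
def ribbonPos (b : List ℕ) (c : ℕ × ℕ) : ℕ := c.1 + (ribbonStart b 0 + b.getD 0 0) - (c.2 + 1)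

section Ribbon

variable {n : ℕ} {β : Composition n}

theorem ribbonStart_add_le {i j : ℕ} (hij : i < j) (hj : j < β.blocks.length) :
    ribbonStart β.blocks j + β.blocks.getD j 0 ≤ ribbonStart β.blocks i + 1 := by
  obtain ⟨k, rfl⟩ : ∃ k, j = k + 1 := ⟨j - 1, by omega⟩
  have h1 := ribbonStart_succ hj
  have h2 := ribbonStart_anti β.blocks (show i ≤ k by omega)
  have h3 := β.blocks_pos (List.getElem_mem hj)
  rw [List.getD_eq_getElem _ _ hj]
  omega

theorem col_le_of_row_lt {c d : ℕ × ℕ} (hc : c ∈ (ribbon β).cells) (hd : d ∈ (ribbon β).cells)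
    (h : c.1 < d.1) : d.2 ≤ c.2 := by
  rw [mem_ribbon_cells] at hc hd
  have := ribbonStart_add_le h hd.1
  omega

/-- On boxes of the ribbon the subtraction in `ribbonPos` is never truncated. -/
theorem ribbonPos_add {c : ℕ × ℕ} (hc : c ∈ (ribbon β).cells) :
    ribbonPos β.blocks c + c.2 + 1 = c.1 + (ribbonStart β.blocks 0 + β.blocks.getD 0 0) := by
  have h1 : c.2 + 1 ≤ ribbonStart β.blocks 0 + β.blocks.getD 0 0 := by
    rw [mem_ribbon_cells] at hc
    rcases Nat.eq_zero_or_pos c.1 with h | h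
    · rw [h] at hc
      omega
    · have h2 := ribbonStart_add_le h hc.1
      have h3 := β.blocks_pos (List.getElem_mem (show 0 < β.blocks.length by omega))
      rw [List.getD_eq_getElem _ _ (show 0 < β.blocks.length by omega)]
      omega
  unfold ribbonPos
  omega

theorem ribbonPos_injOn {c d : ℕ × ℕ} (hc : c ∈ (ribbon β).cells) (hd : d ∈ (ribbon β).cells)
    (h : ribbonPos β.blocks c = ribbonPos β.blocks d) : c = d := by
  have h1 := ribbonPos_add hc
  have h2 := ribbonPos_add hd
  rcases lt_trichotomy c.1 d.1 with h3 | h3 | h3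
  · have := col_le_of_row_lt hc hd h3
    omega
  · exact Prod.ext h3 (by omega)
  · have := col_le_of_row_lt hd hc h3
    omega

theorem start_mem_ribbon {i : ℕ} (hi : i < β.blocks.length) :
    (i, ribbonStart β.blocks i) ∈ (ribbon β).cells := by
  rw [mem_ribbon_cells]
  have h3 := β.blocks_pos (List.getElem_mem hi)
  rw [List.getD_eq_getElem _ _ hi]
  exact ⟨hi, le_rfl, by omega⟩

theorem below_start_mem_ribbon {i : ℕ} (hi : i + 1 < β.blocks.length) :
    (i + 1, ribbonStart β.blocks i) ∈ (ribbon β).cells := by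
  rw [mem_ribbon_cells]
  have h1 := ribbonStart_succ hi
  have h3 := β.blocks_pos (List.getElem_mem hi)
  rw [List.getD_eq_getElem _ _ hi]
  exact ⟨hi, by omega, by omega⟩

theorem size_eq (h : β.blocks ≠ []) :
    n + 1 = ribbonStart β.blocks 0 + β.blocks.getD 0 0 + β.blocks.length := by
  have hl := List.length_pos_iff.2 h
  have h1 := sum_take_add_ribbonStart β.blocks (fun r hr => β.blocks_pos hr)
    (show β.blocks.length - 1 < β.blocks.length by omega)
  rw [Nat.sub_add_cancel hl, List.take_length, β.blocks_sum, ribbonStart,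
    Nat.sub_add_cancel hl, List.drop_length] at h1
  simp only [List.map_nil, List.sum_nil] at h1
  omega

theorem ribbonPos_lt {c : ℕ × ℕ} (hc : c ∈ (ribbon β).cells) : ribbonPos β.blocks c < n := by
  have h1 := ribbonPos_add hc
  rw [mem_ribbon_cells] at hc
  have h2 := size_eq (β := β) (by rintro h; rw [h] at hc; simp at hc)
  omega

/-- The box following a box in the reading order. -/
theorem next_box {c : ℕ × ℕ} (hc : c ∈ (ribbon β).cells) (hn : ribbonPos β.blocks c + 1 < n) :
    (ribbonStart β.blocks c.1 < c.2 ∧ (c.1, c.2 - 1) ∈ (ribbon β).cells ∧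
        ribbonPos β.blocks (c.1, c.2 - 1) = ribbonPos β.blocks c + 1) ∨
      (ribbonStart β.blocks c.1 = c.2 ∧ c.1 + 1 < β.blocks.length ∧
        (c.1 + 1, c.2) ∈ (ribbon β).cells ∧
        ribbonPos β.blocks (c.1 + 1, c.2) = ribbonPos β.blocks c + 1) := by
  have h1 := ribbonPos_add hc
  have hc' := hc
  rw [mem_ribbon_cells] at hc'
  have h2 := size_eq (β := β) (by rintro h; rw [h] at hc'; simp at hc')
  rcases eq_or_lt_of_le hc'.2.1 with h3 | h3
  · right
    have h4 : c.1 + 1 < β.blocks.length := by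
      by_contra h4
      have h5 : c.1 + 1 = β.blocks.length := by omega
      have h6 : ribbonStart β.blocks c.1 = 0 := by
        rw [ribbonStart, h5, List.drop_length]
        rfl
      omega
    have h5 := below_start_mem_ribbon h4
    rw [h3] at h5
    have h6 := ribbonPos_add h5
    exact ⟨h3, h4, h5, by simp only at h6; omega⟩
  · left
    have h5 : (c.1, c.2 - 1) ∈ (ribbon β).cells := by
      rw [mem_ribbon_cells]
      omega
    have h6 := ribbonPos_add h5
    exact ⟨h3, h5, by simp only at h6; omega⟩

theorem exists_ribbonPos_eq {k : ℕ} (hk : k < n) :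
    ∃ c ∈ (ribbon β).cells, ribbonPos β.blocks c = k := by
  induction k with
  | zero =>
    have hb : β.blocks ≠ [] := by
      intro h
      have := β.blocks_sum
      rw [h] at this
      simp at this
      omega
    have hl := List.length_pos_iff.2 hb
    have h3 := β.blocks_pos (List.getElem_mem hl)
    rw [← List.getD_eq_getElem _ 0 hl] at h3
    have h4 : (0, ribbonStart β.blocks 0 + β.blocks.getD 0 0 - 1) ∈ (ribbon β).cells := by
      rw [mem_ribbon_cells]
      exact ⟨hl, by omega, by omega⟩
    have := ribbonPos_add h4
    exact ⟨_, h4, by simp only at this; omega⟩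
  | succ k ih =>
    obtain ⟨c, hc, rfl⟩ := ih (by omega)
    rcases next_box hc hk with ⟨-, h1, h2⟩ | ⟨-, -, h1, h2⟩
    · exact ⟨_, h1, h2⟩
    · exact ⟨_, h1, h2⟩

/-- The ascent pattern of the words read from the tableaux of a ribbon. -/
def ribbonPattern (β : Composition n) : List Bool := patternRev β.blocks.reverse

theorem length_ribbonPattern (hn : 0 < n) : (ribbonPattern β).length + 1 = n := by
  rw [ribbonPattern, length_patternRev, List.sum_reverse, β.blocks_sum]
  · intro h
    have := β.blocks_sum
    rw [List.reverse_eq_nil_iff.1 h] at this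
    simp at this
    omega
  · intro r hr
    exact β.blocks_pos (List.mem_reverse.1 hr)

/-- The reading word ascends exactly where the ribbon steps down. -/
theorem getD_ribbonPattern {c : ℕ × ℕ} (hc : c ∈ (ribbon β).cells)
    (hn : ribbonPos β.blocks c + 1 < n) :
    (ribbonPattern β).getD (ribbonPos β.blocks c) false = true ↔
      c.2 = ribbonStart β.blocks c.1 := by
  have hpos : ∀ r ∈ β.blocks, 0 < r := fun r hr => β.blocks_pos hr
  rw [ribbonPattern, getD_patternRev (fun r hr => hpos r (List.mem_reverse.1 hr))
    (by rwa [List.sum_reverse, β.blocks_sum])]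
  have h1 := ribbonPos_add hc
  constructor
  · rintro ⟨t, ht1, ht2, ht⟩
    rw [List.length_reverse] at ht2
    rw [List.drop_reverse, List.sum_reverse] at ht
    obtain ⟨i, hi⟩ : ∃ i, β.blocks.length - t = i + 1 := ⟨β.blocks.length - t - 1, by omega⟩
    have h2 := sum_take_add_ribbonStart β.blocks hpos (i := i) (by omega)
    have h3 := start_mem_ribbon (β := β) (i := i) (by omega)
    have h4 := ribbonPos_add h3
    rw [hi] at ht
    rw [ribbonPos_injOn hc h3 (by simp only at h4; omega)]
  · intro h
    rcases next_box hc hn with ⟨h2, -⟩ | ⟨-, h2, -⟩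
    · omega
    · have h3 := sum_take_add_ribbonStart β.blocks hpos (i := c.1) (by omega)
      refine ⟨β.blocks.length - (c.1 + 1), by omega, by rw [List.length_reverse]; omega, ?_⟩
      rw [List.drop_reverse, List.sum_reverse,
        show β.blocks.length - (β.blocks.length - (c.1 + 1)) = c.1 + 1 by omega]
      omega

open Classical in
/-- The box of a ribbon at a given position. -/
noncomputable def boxAt (β : Composition n) (k : ℕ) : ℕ × ℕ :=
  if h : k < n then (exists_ribbonPos_eq (β := β) h).choose else (0, 0)

theorem boxAt_mem {k : ℕ} (h : k < n) : boxAt β k ∈ (ribbon β).cells := by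
  rw [boxAt, dif_pos h]
  exact (exists_ribbonPos_eq (β := β) h).choose_spec.1

theorem ribbonPos_boxAt {k : ℕ} (h : k < n) : ribbonPos β.blocks (boxAt β k) = k := by
  rw [boxAt, dif_pos h]
  exact (exists_ribbonPos_eq (β := β) h).choose_spec.2

theorem boxAt_ribbonPos {c : ℕ × ℕ} (hc : c ∈ (ribbon β).cells) :
    boxAt β (ribbonPos β.blocks c) = c :=
  ribbonPos_injOn (boxAt_mem (ribbonPos_lt hc)) hc (ribbonPos_boxAt (ribbonPos_lt hc))

/-- The reading word of a filling of a ribbon. -/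
noncomputable def readingWord (β : Composition n) (f : ℕ → ℕ → ℕ) : List ℕ :=
  (List.range n).map fun k => f (boxAt β k).1 (boxAt β k).2

theorem length_readingWord (f : ℕ → ℕ → ℕ) : (readingWord β f).length = n := by
  simp [readingWord]

theorem getD_readingWord (f : ℕ → ℕ → ℕ) {c : ℕ × ℕ} (hc : c ∈ (ribbon β).cells) :
    (readingWord β f).getD (ribbonPos β.blocks c) 0 = f c.1 c.2 := by
  rw [List.getD_eq_getElem _ _ (by rw [length_readingWord]; exact ribbonPos_lt hc)]
  simp only [readingWord, List.getElem_map, List.getElem_range, boxAt_ribbonPos hc]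

theorem content_readingWord (f : ℕ → ℕ → ℕ) :
    content (readingWord β f) = fillingContent (ribbon β).cells f := by
  have h : ∀ g : ℕ → ℕ →₀ ℕ, ((List.range n).map g).sum = ∑ k ∈ range n, g k := fun g => by
    rw [Finset.sum_eq_multiset_sum, Finset.range_val, Multiset.range, Multiset.map_coe,
      Multiset.sum_coe]
  rw [content, readingWord, List.map_map, h, fillingContent]
  refine Finset.sum_bij' (fun k _ => boxAt β k) (fun c _ => ribbonPos β.blocks c)
    (fun k hk => boxAt_mem (mem_range.1 hk)) (fun c hc => mem_range.2 (ribbonPos_lt hc))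
    (fun k hk => ribbonPos_boxAt (mem_range.1 hk)) (fun c hc => boxAt_ribbonPos hc)
    fun k _ => rfl

theorem hasPattern_readingWord (hn : 0 < n) (T : SkewTableau (ribbon β)) :
    HasPattern (ribbonPattern β) (readingWord β T.entry) := by
  have hlen := length_ribbonPattern (β := β) hn
  rw [hasPattern_iff_getD]
  refine ⟨by rw [length_readingWord, hlen], fun k hk => ?_⟩
  obtain ⟨c, hc, rfl⟩ := exists_ribbonPos_eq (β := β) (show k < n by omega)
  rw [getD_ribbonPattern hc (by omega), getD_readingWord _ hc]
  rcases next_box hc (by omega) with ⟨h1, h2, h3⟩ | ⟨h1, -, h2, h3⟩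
  · rw [← h3, getD_readingWord _ h2]
    have := T.row_weak (show c.2 - 1 < c.2 by omega) h2 hc
    constructor
    · intro h
      simp only at h
      omega
    · intro h
      omega
  · rw [← h3, getD_readingWord _ h2]
    exact ⟨fun _ => h1.symm, fun _ => T.col_strict (by omega) hc h2⟩

/-- A row of length at least 2 begins strictly left of its overlap with the row above, and the rows
below it reach no further right than its first column. So no column meets three rows. -/
theorem row_eq_of_col_eq (h2 : ∀ x ∈ β.blocks, 2 ≤ x) {i i' j : ℕ} (hi : i < i')
    (hc : (i, j) ∈ (ribbon β).cells) (hd : (i', j) ∈ (ribbon β).cells) :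
    i' = i + 1 ∧ j = ribbonStart β.blocks i := by
  have hc' := hc
  have hd' := hd
  rw [mem_ribbon_cells] at hc' hd'
  have h4 := ribbonStart_add_le hi hd'.1
  have h5 : i' = i + 1 := by
    by_contra h5
    have hlt : i + 1 < β.blocks.length := by omega
    have h6 := ribbonStart_add_le (show i < i + 1 by omega) hlt
    have h7 := ribbonStart_add_le (show i + 1 < i' by omega) hd'.1
    have h8 := h2 _ (List.getElem_mem hlt)
    rw [← List.getD_eq_getElem _ 0 hlt] at h8
    omega
  exact ⟨h5, by omega⟩

open Classical in
/-- The filling of a ribbon with a given reading word. -/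
noncomputable def fillingOfWord (β : Composition n) (w : List ℕ) (i j : ℕ) : ℕ :=
  if (i, j) ∈ (ribbon β).cells then w.getD (ribbonPos β.blocks (i, j)) 0 else 0

theorem fillingOfWord_of_mem (w : List ℕ) {i j : ℕ} (h : (i, j) ∈ (ribbon β).cells) :
    fillingOfWord β w i j = w.getD (ribbonPos β.blocks (i, j)) 0 := if_pos h

/-- The ribbon tableau with a given reading word. -/
noncomputable def tableauOfWord (hn : 0 < n) (h2 : ∀ x ∈ β.blocks, 2 ≤ x) (w : List ℕ)
    (hw : HasPattern (ribbonPattern β) w) : SkewTableau (ribbon β) where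
  entry := fillingOfWord β w
  row_weak {i j₁ j₂} hj h₁ h₂ := by
    have hlen := length_ribbonPattern (β := β) hn
    rw [hasPattern_iff_getD] at hw
    revert h₂
    induction j₂, hj.le using Nat.le_induction with
    | base => exact fun _ => le_rfl
    | succ j hj' ih =>
      intro h₂
      have h₃ : (i, j) ∈ (ribbon β).cells := by
        rw [mem_ribbon_cells] at h₁ h₂ ⊢
        omega
      have h4 : fillingOfWord β w i j₁ ≤ fillingOfWord β w i j := by
        rcases eq_or_lt_of_le hj' with h | h
        · rw [h]
        · exact ih h h₃
      refine h4.trans ?_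
      have h5 := ribbonPos_add h₂
      have h6 := ribbonPos_add h₃
      simp only at h5 h6
      have h7 : ribbonPos β.blocks (i, j) = ribbonPos β.blocks (i, j + 1) + 1 := by omega
      have h8 := ribbonPos_lt h₃
      rw [fillingOfWord_of_mem _ h₃, fillingOfWord_of_mem _ h₂, h7, ← not_lt,
        hw.2 _ (by omega), getD_ribbonPattern h₂ (by omega)]
      rw [mem_ribbon_cells] at h₃
      simp only
      omega
  col_strict {i₁ i₂ j} hi h₁ h₂ := by
    have hlen := length_ribbonPattern (β := β) hn
    rw [hasPattern_iff_getD] at hw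
    obtain ⟨rfl, h3⟩ := row_eq_of_col_eq h2 hi h₁ h₂
    have h5 := ribbonPos_add h₂
    have h6 := ribbonPos_add h₁
    simp only at h5 h6
    have h7 : ribbonPos β.blocks (i₁ + 1, j) = ribbonPos β.blocks (i₁, j) + 1 := by omega
    have h8 := ribbonPos_lt h₂
    rw [fillingOfWord_of_mem _ h₁, fillingOfWord_of_mem _ h₂, h7, hw.2 _ (by omega),
      getD_ribbonPattern h₁ (by omega)]
    exact h3
  zeros h := if_neg h

theorem readingWord_fillingOfWord {w : List ℕ} (hw : w.length = n) :
    readingWord β (fillingOfWord β w) = w := by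
  refine List.ext_getElem (by rw [length_readingWord, hw]) fun k h1 h2 => ?_
  rw [length_readingWord] at h1
  have h3 := getD_readingWord (fillingOfWord β w) (boxAt_mem (β := β) h1)
  have h4 : fillingOfWord β w (boxAt β k).1 (boxAt β k).2 =
      w.getD (ribbonPos β.blocks (boxAt β k)) 0 := if_pos (boxAt_mem h1)
  rw [h4, ribbonPos_boxAt h1, List.getD_eq_getElem _ _ h2,
    List.getD_eq_getElem _ _ (by rwa [length_readingWord])] at h3
  exact h3

theorem SkewTableau.ext_entry {A : SkewShape} {S T : SkewTableau A} (h : S.entry = T.entry) :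
    S = T := by
  cases S
  cases T
  cases h
  rfl

/-- Ribbon tableaux correspond to words with the ascent pattern of the ribbon. -/
theorem coeff_wordSum (hn : 0 < n) (h2 : ∀ x ∈ β.blocks, 2 ≤ x) {N : ℕ} {m : ℕ →₀ ℕ}
    (hm : m.support ⊆ range N) :
    (wordSum (MvPolynomial.X : ℕ → MvPolynomial ℕ ℚ) N (ribbonPattern β)).coeff m =
      (ribbon β).schurFunction m := by
  classical
  have hprod : ∀ w : List ℕ, (w.map (MvPolynomial.X : ℕ → MvPolynomial ℕ ℚ)).prod =
      MvPolynomial.monomial (content w) 1 := fun w => by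
    induction w with
    | nil => simp [content_nil]
    | cons a w ih =>
      rw [List.map_cons, List.prod_cons, ih, content_cons, MvPolynomial.X,
        MvPolynomial.monomial_mul, one_mul]
  rw [wordSum, MvPolynomial.coeff_sum, SkewShape.schurFunction]
  simp only [hprod, MvPolynomial.coeff_monomial]
  rw [Finset.sum_boole, ← Nat.card_eq_finsetCard]
  congr 1
  have hlen : ∀ {w}, HasPattern (ribbonPattern β) w → w.length = n := fun {w} hw => by
    rw [(hasPattern_iff_getD.1 hw).1, length_ribbonPattern hn]
  symm
  refine Nat.card_congr ⟨fun T => ⟨readingWord β T.1.entry, ?_⟩,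
    fun w => ⟨tableauOfWord hn h2 w.1 (mem_words.1 (mem_filter.1 w.2).1).1, ?_⟩, fun T => ?_,
    fun w => ?_⟩
  · have hcont : content (readingWord β T.1.entry) = m := by rw [content_readingWord, T.2]
    refine mem_filter.2 ⟨mem_words.2 ⟨hasPattern_readingWord hn T.1, fun y hy => ?_⟩, hcont⟩
    rw [← mem_range]
    refine hm ?_
    rw [← hcont, Finsupp.mem_support_iff, content_apply]
    exact (List.count_pos_iff.2 hy).ne'
  · have hw := mem_filter.1 w.2
    rw [← content_readingWord]
    show content (readingWord β (fillingOfWord β w.1)) = m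
    rw [readingWord_fillingOfWord (hlen (mem_words.1 hw.1).1)]
    exact hw.2
  · refine Subtype.ext (SkewTableau.ext_entry ?_)
    funext i j
    show fillingOfWord β (readingWord β T.1.entry) i j = T.1.entry i j
    by_cases h : (i, j) ∈ (ribbon β).cells
    · rw [fillingOfWord_of_mem _ h, getD_readingWord _ h]
    · rw [T.1.zeros h]
      exact if_neg h
  · refine Subtype.ext ?_
    exact readingWord_fillingOfWord (hlen (mem_words.1 (mem_filter.1 w.2).1).1)

end Ribbon

/-! ### Linear independence of the Schur functions -/

/-- The sum of the first `k` row lengths. -/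
def partialSum (nu : YoungDiagram) (k : ℕ) : ℕ := ∑ i ∈ range k, nu.rowLen i

theorem partialSum_injective : Function.Injective partialSum := fun nu mu h => by
  refine rowsOf_injective (Finsupp.ext fun i => ?_)
  have h1 := congrFun h (i + 1)
  have h2 := congrFun h i
  unfold partialSum at h1 h2
  rw [Finset.sum_range_succ, Finset.sum_range_succ, h2] at h1
  rw [rowsOf_apply, rowsOf_apply]
  exact Nat.add_left_cancel h1

theorem le_entry {mu : YoungDiagram} (T : SemistandardYoungTableau mu) {i j : ℕ}
    (h : (i, j) ∈ mu) : i ≤ T i j := by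
  induction i with
  | zero => exact Nat.zero_le _
  | succ i ih =>
    have h1 := ih (mu.up_left_mem (Nat.le_succ i) le_rfl h)
    have h2 := T.col_strict (show i < i + 1 by omega) h
    omega

theorem sum_range_rowLen (mu : YoungDiagram) (k : ℕ) :
    ∑ i ∈ range k, mu.rowLen i = (mu.cells.filter fun c => c.1 < k).card := by
  rw [Finset.card_eq_sum_card_fiberwise (f := Prod.fst) (t := range k)]
  · refine Finset.sum_congr rfl fun i hi => ?_
    rw [YoungDiagram.rowLen_eq_card, YoungDiagram.row, Finset.filter_filter]
    congr 1
    refine Finset.filter_congr fun c _ => ?_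
    rw [mem_range] at hi
    omega
  · intro c hc
    rw [mem_coe, mem_filter] at hc
    rw [mem_coe, mem_range]
    exact hc.2

theorem sum_range_fillingContent (D : Finset (ℕ × ℕ)) (T : ℕ → ℕ → ℕ) (k : ℕ) :
    ∑ a ∈ range k, fillingContent D T a = (D.filter fun c => T c.1 c.2 < k).card := by
  rw [Finset.card_eq_sum_card_fiberwise (f := fun c : ℕ × ℕ => T c.1 c.2) (t := range k)]
  · refine Finset.sum_congr rfl fun a ha => ?_
    rw [fillingContent_apply, Finset.filter_filter]
    congr 1
    refine Finset.filter_congr fun c _ => ?_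
    rw [mem_range] at ha
    omega
  · intro c hc
    rw [mem_coe, mem_filter] at hc
    rw [mem_coe, mem_range]
    exact hc.2

/-- Triangularity of the Kostka numbers. -/
theorem partialSum_le_of_schurFunction_ne_zero {mu nu : YoungDiagram}
    (h : schurFunction mu (rowsOf nu) ≠ 0) : partialSum nu ≤ partialSum mu := by
  intro k
  have h1 : Nonempty {T : SemistandardYoungTableau mu //
      fillingContent mu.cells T = rowsOf nu} := by
    by_contra hcon
    rw [not_nonempty_iff] at hcon
    exact h (by rw [schurFunction, Nat.card_of_isEmpty, Nat.cast_zero])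
  obtain ⟨T, hT⟩ := h1
  have h2 : partialSum nu k = ∑ a ∈ range k, rowsOf nu a :=
    Finset.sum_congr rfl fun i _ => (rowsOf_apply nu i).symm
  rw [h2, ← hT, sum_range_fillingContent, partialSum, sum_range_rowLen]
  refine Finset.card_le_card fun c hc => ?_
  rw [mem_filter] at hc ⊢
  exact ⟨hc.1, (le_entry T hc.1).trans_lt hc.2⟩

theorem finite_tableaux_of_content (nu : YoungDiagram) (m : ℕ →₀ ℕ) :
    Finite {T : SemistandardYoungTableau nu // fillingContent nu.cells T = m} := by
  obtain ⟨N, hN⟩ := exists_forall_ge_eq_zero m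
  have hm : m.support ⊆ range N := fun i hi => by
    rw [mem_range]
    by_contra h
    exact (Finsupp.mem_support_iff.1 hi) (hN i (by omega))
  have := (finite_isTableau (rowsOf nu) N).to_subtype
  refine Finite.of_injective (β := {f | IsTableau (rowsOf nu) N f})
    (fun T => ⟨T.1, isTableau_entry T.1 fun c hc => lt_of_fillingContent hm T.2 hc⟩)
    fun S T h => ?_
  have h1 := congrArg Subtype.val h
  exact Subtype.ext (SemistandardYoungTableau.ext fun i j => congrFun (congrFun h1 i) j)

theorem schurFunction_rowsOf_self_ne_zero (nu : YoungDiagram) :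
    schurFunction nu (rowsOf nu) ≠ 0 := by
  have := finite_tableaux_of_content nu (rowsOf nu)
  have h1 : Nonempty {T : SemistandardYoungTableau nu //
      fillingContent nu.cells T = rowsOf nu} := by
    refine ⟨⟨SemistandardYoungTableau.highestWeight nu, ?_⟩⟩
    ext a
    rw [fillingContent_apply, rowsOf_apply, YoungDiagram.rowLen_eq_card, YoungDiagram.row]
    congr 1
    refine Finset.filter_congr fun c hc => ?_
    rw [SemistandardYoungTableau.highestWeight_apply, if_pos (show (c.1, c.2) ∈ nu from hc)]
  exact Nat.cast_ne_zero.2 Nat.card_pos.ne'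

theorem linearIndependent_schurFunction : LinearIndependent ℚ schurFunction := by
  rw [linearIndependent_iff]
  intro d hd
  by_contra hne
  -- Take a dominance-maximal shape of the support. By triangularity no other shape in the support
  -- contributes to the coefficient of the monomial given by its row lengths.
  obtain ⟨nu, hnu⟩ := d.support.exists_maximalFor partialSum (Finsupp.support_nonempty_iff.2 hne)
  have h1 := congrArg (MvPowerSeries.coeff (rowsOf nu)) hd
  rw [Finsupp.linearCombination_apply, Finsupp.sum, map_sum, map_zero,
    Finset.sum_eq_single nu] at h1
  · rw [map_smul, smul_eq_mul] at h1
    rcases mul_eq_zero.1 h1 with h2 | h2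
    · exact (Finsupp.mem_support_iff.1 hnu.1) h2
    · exact schurFunction_rowsOf_self_ne_zero nu h2
  · intro mu hmu hmunu
    rw [map_smul, smul_eq_mul]
    refine mul_eq_zero_of_right _ ?_
    by_contra hcon
    have h2 := partialSum_le_of_schurFunction_ne_zero (mu := mu) (nu := nu) hcon
    exact hmunu (partialSum_injective (le_antisymm (hnu.2 hmu h2) h2))
  · intro h
    exact absurd hnu.1 h

/-! ### The Schur support of a ribbon -/

section Expansion

variable {n : ℕ} {β : Composition n}

open Classical in
/-- The lattice words with the ascent pattern of a ribbon. -/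
noncomputable def latticeWords (β : Composition n) : Finset (List ℕ) :=
  (words n (ribbonPattern β)).filter (IsLattice 0)

theorem antitone_zero : Antitone ⇑(0 : ℕ →₀ ℕ) := fun _ _ _ => le_rfl

theorem antitone_content {w : List ℕ} (h : IsLattice 0 w) : Antitone (content w) := by
  simpa using h.antitone antitone_zero

/-- A letter `y` forces rows `0` to `y` of the resulting partition to be non-empty. Hence bounding
letters by the size of the ribbon loses no lattice word. -/
theorem IsLattice.lt_length {w : List ℕ} (h : IsLattice 0 w) {y : ℕ} (hy : y ∈ w) :
    y < w.length := by
  have h1 := sum_range_le_degree (content w) (y + 1)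
  have h2 : (range (y + 1)).card • 1 ≤ ∑ i ∈ range (y + 1), content w i :=
    Finset.card_nsmul_le_sum _ _ _ fun i hi => by
      rw [mem_range] at hi
      have h3 := antitone_content h (show i ≤ y by omega)
      rw [content_apply w y] at h3
      have := List.count_pos_iff.2 hy
      omega
  rw [card_range, smul_eq_mul, mul_one] at h2
  rw [degree_content] at h1
  omega

theorem mem_latticeWords (hn : 0 < n) {w : List ℕ} :
    w ∈ latticeWords β ↔ HasPattern (ribbonPattern β) w ∧ IsLattice 0 w := by
  classical
  rw [latticeWords, mem_filter, mem_words]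
  constructor
  · rintro ⟨⟨h1, -⟩, h2⟩
    exact ⟨h1, h2⟩
  · rintro ⟨h1, h2⟩
    refine ⟨⟨h1, fun y hy => ?_⟩, h2⟩
    have := h2.lt_length hy
    rwa [(hasPattern_iff_getD.1 h1).1, length_ribbonPattern hn] at this

open Classical in
/-- The Young diagram formed by the letters of a lattice word. -/
noncomputable def shapeOf (w : List ℕ) : YoungDiagram :=
  if h : IsLattice 0 w then (exists_rowsOf_eq (antitone_content h)).choose else ⊥

theorem rowsOf_shapeOf {w : List ℕ} (h : IsLattice 0 w) : rowsOf (shapeOf w) = content w := by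
  rw [shapeOf, dif_pos h]
  exact (exists_rowsOf_eq (antitone_content h)).choose_spec

/-- The coefficients of the Schur expansion of a ribbon. -/
noncomputable def ribbonCoeff (β : Composition n) : YoungDiagram →₀ ℚ :=
  ∑ w ∈ latticeWords β, Finsupp.single (shapeOf w) 1

/-- The Littlewood-Richardson rule for ribbons. -/
theorem isSchurExpansion_ribbonCoeff (hn : 0 < n) (h2 : ∀ x ∈ β.blocks, 2 ≤ x) :
    (ribbon β).IsSchurExpansion (ribbonCoeff β) := by
  classical
  rw [SkewShape.IsSchurExpansion, ← Finsupp.linearCombination_apply, ribbonCoeff, map_sum]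
  simp only [Finsupp.linearCombination_single, one_smul]
  refine MvPowerSeries.ext fun m => ?_
  rw [map_sum]
  obtain ⟨N₀, hN₀⟩ := exists_forall_ge_eq_zero m
  obtain ⟨N, hN, hNn⟩ : ∃ N, N₀ ≤ N ∧ n ≤ N := ⟨max N₀ n, le_max_left _ _, le_max_right _ _⟩
  have hm : m.support ⊆ range N := fun i hi => by
    rw [mem_range]
    by_contra h
    exact (Finsupp.mem_support_iff.1 hi) (hN₀ i (by omega))
  show (ribbon β).schurFunction m = ∑ w ∈ latticeWords β, schurFunction (shapeOf w) m
  rw [← coeff_wordSum hn h2 hm, wordSum_eq_sum_schurPoly, ← Finset.sum_filter,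
    MvPolynomial.coeff_sum]
  refine Finset.sum_congr ?_ fun w hw => ?_
  · ext w
    rw [mem_latticeWords hn, mem_filter, mem_words]
    constructor
    · rintro ⟨⟨h1, -⟩, h3⟩
      exact ⟨h1, h3⟩
    · rintro ⟨h1, h3⟩
      refine ⟨⟨h1, fun y hy => ?_⟩, h3⟩
      have := h3.lt_length hy
      rw [(hasPattern_iff_getD.1 h1).1, length_ribbonPattern hn] at this
      omega
  · rw [← coeff_schurPoly _ hm, rowsOf_shapeOf ((mem_latticeWords hn).1 hw).2]

/-- Linear independence makes the expansion unique, and its coefficients count lattice words, so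
positivity amounts to the existence of one. -/
theorem mem_schurSupport_ribbon (hn : 0 < n) (h2 : ∀ x ∈ β.blocks, 2 ≤ x) {nu : YoungDiagram} :
    nu ∈ (ribbon β).schurSupport ↔
      ∃ w, HasPattern (ribbonPattern β) w ∧ IsLattice 0 w ∧ content w = rowsOf nu := by
  classical
  have hexp := isSchurExpansion_ribbonCoeff hn h2
  have hval : ribbonCoeff β nu = ((latticeWords β).filter fun w => shapeOf w = nu).card := by
    rw [ribbonCoeff, Finsupp.finsetSum_apply, ← Finset.sum_boole]
    exact Finset.sum_congr rfl fun w _ => Finsupp.single_apply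
  have h1 : nu ∈ (ribbon β).schurSupport ↔ 0 < ribbonCoeff β nu := by
    constructor
    · rintro ⟨c, hc, hpos⟩
      have h3 : c = ribbonCoeff β := by
        refine linearIndependent_schurFunction ?_
        rw [Finsupp.linearCombination_apply, Finsupp.linearCombination_apply]
        exact hc.symm.trans hexp
      rwa [← h3]
    · exact fun h => ⟨_, hexp, h⟩
  rw [h1, hval, Nat.cast_pos, Finset.card_pos]
  constructor
  · rintro ⟨w, hw⟩
    rw [mem_filter, mem_latticeWords hn] at hw
    exact ⟨w, hw.1.1, hw.1.2, by rw [← rowsOf_shapeOf hw.1.2, hw.2]⟩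
  · rintro ⟨w, h3, h4, h5⟩
    refine ⟨w, mem_filter.2 ⟨(mem_latticeWords hn).2 ⟨h3, h4⟩, rowsOf_injective ?_⟩⟩
    rw [rowsOf_shapeOf h4, h5]

end Expansion

/-! ### The dominance interval of a ribbon -/

theorem rowLen_ofRowLens' {w : List ℕ} (hw : w.SortedGE) (i : ℕ) :
    (YoungDiagram.ofRowLens w hw).rowLen i = w.getD i 0 := by
  refine eq_of_forall_lt_iff fun j => ?_
  rw [← YoungDiagram.mem_iff_lt_rowLen, YoungDiagram.mem_ofRowLens]
  constructor
  · rintro ⟨h1, h2⟩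
    rwa [List.getD_eq_getElem _ _ h1]
  · intro h
    have h1 : i < w.length := by
      by_contra h1
      rw [List.getD_eq_default _ _ (by omega)] at h
      omega
    rw [List.getD_eq_getElem _ _ h1] at h
    exact ⟨h1, h⟩

theorem sum_range_getD (l : List ℕ) (k : ℕ) :
    ∑ i ∈ range k, l.getD i 0 = (l.take k).sum := by
  induction k generalizing l with
  | zero => simp
  | succ k ih =>
    cases l with
    | nil => simp
    | cons a l =>
      rw [Finset.sum_range_succ', List.take_succ_cons, List.sum_cons, ← ih l, add_comm]
      simp

theorem sum_range_rowLen_sortedDiagram (w : List ℕ) (k : ℕ) :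
    ∑ i ∈ range k, (sortedDiagram w).rowLen i = ((w.insertionSort (· ≥ ·)).take k).sum := by
  rw [← sum_range_getD]
  exact Finset.sum_congr rfl fun i _ => rowLen_ofRowLens' _ i

theorem card_sortedDiagram (w : List ℕ) : (sortedDiagram w).card = w.sum := by
  have hlen := (List.perm_insertionSort (· ≥ ·) w).length_eq
  have hrow : ∀ i, rowsOf (sortedDiagram w) i = (w.insertionSort (· ≥ ·)).getD i 0 := fun i => by
    rw [rowsOf_apply]
    exact rowLen_ofRowLens' _ i
  rw [← degree_rowsOf, ← sum_range_eq_degree (N := w.length),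
    Finset.sum_congr rfl fun i _ => hrow i, sum_range_getD, ← hlen, List.take_length,
    (List.perm_insertionSort (· ≥ ·) w).sum_eq]
  intro i hi
  rw [hrow, List.getD_eq_default _ _ (by omega)]

theorem sum_le_sum_take {l : List ℕ} (hl : l.Pairwise (· ≥ ·)) {s : Multiset ℕ}
    (hs : s ≤ (l : Multiset ℕ)) : s.sum ≤ (l.take (Multiset.card s)).sum := by
  induction l generalizing s with
  | nil =>
    rw [Multiset.le_zero.1 hs]
    simp
  | cons a l ih =>
    rcases Multiset.empty_or_exists_mem s with rfl | ⟨y, hy⟩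
    · simp
    have hya : y ≤ a := by
      rcases List.mem_cons.1 (Multiset.mem_coe.1 (Multiset.mem_of_le hs hy)) with h | h
      · exact h.le
      · exact List.rel_of_pairwise_cons hl h
    rw [← Multiset.cons_coe] at hs
    obtain ⟨z, s', rfl, hz, hs'⟩ : ∃ z s', s = z ::ₘ s' ∧ z ≤ a ∧ s' ≤ (l : Multiset ℕ) := by
      by_cases ha : a ∈ s
      · obtain ⟨s', rfl⟩ := Multiset.exists_cons_of_mem ha
        exact ⟨a, s', rfl, le_rfl, (Multiset.cons_le_cons_iff a).1 hs⟩
      · obtain ⟨s', rfl⟩ := Multiset.exists_cons_of_mem hy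
        exact ⟨y, s', rfl, hya, (Multiset.le_cons_self _ _).trans
          ((Multiset.le_cons_of_notMem ha).1 hs)⟩
    rw [Multiset.sum_cons, Multiset.card_cons, List.take_succ_cons, List.sum_cons]
    exact add_le_add hz (ih hl.of_cons hs')

/-- Among all choices of `k` parts the `k` largest have the greatest sum, so bounding every
sub-multiset is the same as bounding the initial segments of the sorted list. -/
theorem dominatedBy_sortedDiagram_left {b : List ℕ} {nu : YoungDiagram} :
    DominatedBy (sortedDiagram b) nu ↔ (rowsOf nu).degree = b.sum ∧ DomParts b (rowsOf nu) := by
  have hperm := List.perm_insertionSort (· ≥ ·) b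
  have hsum : ∀ k, ∑ i ∈ range k, nu.rowLen i = ∑ i ∈ range k, rowsOf nu i := fun k =>
    Finset.sum_congr rfl fun i _ => (rowsOf_apply nu i).symm
  rw [DominatedBy, card_sortedDiagram, degree_rowsOf, eq_comm]
  simp only [sum_range_rowLen_sortedDiagram, hsum]
  refine and_congr_right fun _ => ⟨fun h s hs => ?_, fun h k => ?_⟩
  · refine le_trans (sum_le_sum_take (List.pairwise_insertionSort (· ≥ ·) b) ?_) (h _)
    rwa [Multiset.coe_eq_coe.2 hperm]
  · have h1 := h (((b.insertionSort (· ≥ ·)).take k : List ℕ) : Multiset ℕ) (by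
      rw [← Multiset.coe_eq_coe.2 hperm, Multiset.coe_le]
      exact (List.take_sublist _ _).subperm)
    rw [Multiset.sum_coe, Multiset.coe_card] at h1
    exact h1.trans (sum_range_mono _ (by rw [List.length_take]; omega))

/-- From the second partial sum on, a two-row shape already contains all boxes, so only the first
row is constrained. -/
theorem dominatedBy_sortedDiagram_pair {a b : ℕ} (hab : b ≤ a) {nu : YoungDiagram} :
    DominatedBy nu (sortedDiagram [a, b]) ↔
      (rowsOf nu).degree = a + b ∧ rowsOf nu 0 ≤ a := by
  have hsort : [a, b].insertionSort (· ≥ ·) = [a, b] :=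
    List.Pairwise.insertionSort_eq (by simpa using hab)
  rw [DominatedBy, card_sortedDiagram, degree_rowsOf, rowsOf_apply]
  simp only [sum_range_rowLen_sortedDiagram, hsort, List.sum_cons, List.sum_nil, add_zero]
  refine and_congr_right fun hc => ⟨fun h => by simpa using h 1, fun h k => ?_⟩
  match k with
  | 0 => simp
  | 1 => simpa using h
  | k + 2 =>
    have h1 := sum_range_le_degree (rowsOf nu) (k + 2)
    rw [degree_rowsOf, hc, Finset.sum_congr rfl fun i _ => rowsOf_apply nu i] at h1
    simpa using h1

theorem lt_countP_iff {l : List ℕ} (hl : l.Pairwise (· ≥ ·)) (i j : ℕ) :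
    j < l.countP (i < ·) ↔ i < l.getD j 0 := by
  induction l generalizing j with
  | nil => simp
  | cons a l ih =>
    rw [List.countP_cons]
    by_cases ha : i < a
    · cases j with
      | zero => simp [ha]
      | succ j => simp [ha, ih hl.of_cons]
    · have h0 : l.countP (i < ·) = 0 := by
        rw [List.countP_eq_zero]
        intro y hy
        have := List.rel_of_pairwise_cons hl hy
        simp only [decide_eq_true_eq]
        omega
      rw [h0]
      cases j with
      | zero => simp [ha]
      | succ j =>
        rw [List.getD_cons_succ, ← ih hl.of_cons, h0]
        simp [ha]

theorem rowLen_transpose_sortedDiagram (w : List ℕ) (i : ℕ) :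
    (sortedDiagram w).transpose.rowLen i = w.countP (i < ·) := by
  rw [YoungDiagram.rowLen_transpose, ← (List.perm_insertionSort (· ≥ ·) w).countP_eq]
  refine eq_of_forall_lt_iff fun j => ?_
  rw [← YoungDiagram.mem_iff_lt_colLen, YoungDiagram.mem_iff_lt_rowLen,
    lt_countP_iff (List.pairwise_insertionSort (· ≥ ·) w)]
  rw [sortedDiagram, rowLen_ofRowLens']

theorem sum_eq_countP_add_countP {l : List ℕ} (h : ∀ x ∈ l, x ≤ 2) :
    l.sum = l.countP (0 < ·) + l.countP (1 < ·) := by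
  induction l with
  | nil => simp
  | cons a l ih =>
    have ha := h a (by simp)
    rw [List.sum_cons, ih fun x hx => h x (by simp [hx]), List.countP_cons, List.countP_cons]
    interval_cases a <;> simp <;> omega

/-- A list of ones and twos has as transpose a two-row shape. -/
theorem transpose_sortedDiagram_of_le_two {w : List ℕ} (h : ∀ x ∈ w, 1 ≤ x ∧ x ≤ 2) {b : ℕ}
    (hsum : w.sum = w.length + b) :
    (sortedDiagram w).transpose = sortedDiagram [w.length, b] := by
  have h0 : w.countP (0 < ·) = w.length :=
    List.countP_eq_length.2 fun x hx => decide_eq_true (h x hx).1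
  have h1 := sum_eq_countP_add_countP fun x hx => (h x hx).2
  have hb : b = w.countP (1 < ·) := by omega
  have hab : b ≤ w.length := hb ▸ List.countP_le_length
  have hsort : [w.length, b].insertionSort (· ≥ ·) = [w.length, b] :=
    List.Pairwise.insertionSort_eq (by simpa using hab)
  refine rowsOf_injective (Finsupp.ext fun i => ?_)
  rw [rowsOf_apply, rowsOf_apply, rowLen_transpose_sortedDiagram, sortedDiagram,
    rowLen_ofRowLens', hsort]
  match i with
  | 0 => simpa using h0
  | 1 => simpa using hb.symm
  | i + 2 =>
    rw [List.countP_eq_zero.2]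
    · simp
    · intro x hx
      have := h x hx
      simp only [decide_eq_true_eq]
      omega

section Ribbon

variable {n : ℕ} {β : Composition n}

theorem rowLen_outer {i : ℕ} (hi : i < β.blocks.length) :
    (ribbon β).outer.rowLen i = ribbonStart β.blocks i + β.blocks[i] := by
  refine (rowLen_ofRowLens' (sortedGE_ribbonOuter β.blocks fun _ h => β.blocks_pos h) i).trans ?_
  rw [List.getD_eq_getElem _ _ (by simpa using hi), List.getElem_map, List.getElem_range,
    List.getD_eq_getElem _ _ hi]

theorem rowLen_outer_of_le {i : ℕ} (hi : β.blocks.length ≤ i) :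
    (ribbon β).outer.rowLen i = 0 :=
  (rowLen_ofRowLens' (sortedGE_ribbonOuter β.blocks fun _ h => β.blocks_pos h) i).trans
    (List.getD_eq_default _ _ (by simpa using hi))

theorem rowLen_inner {i : ℕ} (hi : i < β.blocks.length) :
    (ribbon β).inner.rowLen i = ribbonStart β.blocks i := by
  refine (rowLen_ofRowLens' (sortedGE_ribbonInner β.blocks) i).trans ?_
  rw [List.getD_eq_getElem _ _ (by simpa using hi), List.getElem_map, List.getElem_range]

theorem lt_length_of_mem_outer {c : ℕ × ℕ} (h : c ∈ (ribbon β).outer) :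
    c.1 < β.blocks.length := by
  by_contra hcon
  rw [← Prod.mk.eta (p := c), YoungDiagram.mem_iff_lt_rowLen,
    rowLen_outer_of_le (not_lt.1 hcon)] at h
  exact absurd h (Nat.not_lt_zero _)

theorem colLen_outer_zero : (ribbon β).outer.colLen 0 = β.blocks.length := by
  refine eq_of_forall_lt_iff fun i => ?_
  rw [← YoungDiagram.mem_iff_lt_colLen]
  constructor
  · exact fun h => lt_length_of_mem_outer h
  · intro h
    rw [YoungDiagram.mem_iff_lt_rowLen, rowLen_outer h]
    have := β.blocks_pos (List.getElem_mem h)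
    omega

theorem rowLengths_ribbon : (ribbon β).rowLengths = β.blocks := by
  refine List.ext_getElem ?_ fun i h1 h2 => ?_
  · simp [SkewShape.rowLengths, colLen_outer_zero]
  · simp only [SkewShape.rowLengths, List.getElem_map, List.getElem_range]
    rw [rowLen_outer h2, rowLen_inner h2]
    omega

theorem card_ribbon_cells : (ribbon β).cells.card = n := by
  refine Eq.trans ?_ (Finset.card_range n)
  exact Finset.card_bij' (fun c _ => ribbonPos β.blocks c) (fun k _ => boxAt β k)
    (fun c hc => mem_range.2 (ribbonPos_lt hc)) (fun k hk => boxAt_mem (mem_range.1 hk))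
    (fun c hc => boxAt_ribbonPos hc) fun k hk => ribbonPos_boxAt (mem_range.1 hk)

theorem mem_cells_iff_colLen {A : SkewShape} {i j : ℕ} :
    (i, j) ∈ A.cells ↔ A.inner.colLen j ≤ i ∧ i < A.outer.colLen j := by
  rw [SkewShape.cells, mem_sdiff, YoungDiagram.mem_cells, YoungDiagram.mem_cells,
    YoungDiagram.mem_iff_lt_colLen, YoungDiagram.mem_iff_lt_colLen, not_lt, and_comm]

theorem sum_colLengths (A : SkewShape) : A.colLengths.sum = A.cells.card := by
  have h : ∀ g : ℕ → ℕ, ((List.range (A.outer.rowLen 0)).map g).sum =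
      ∑ k ∈ range (A.outer.rowLen 0), g k := fun g => by
    rw [Finset.sum_eq_multiset_sum, Finset.range_val, Multiset.range, Multiset.map_coe,
      Multiset.sum_coe]
  rw [SkewShape.colLengths, h,
    Finset.card_eq_sum_card_fiberwise (f := Prod.snd) (t := range (A.outer.rowLen 0))]
  · refine Finset.sum_congr rfl fun j _ => ?_
    rw [← Nat.card_Ico]
    refine Finset.card_bij (fun i _ => (i, j)) (fun i hi => ?_)
      (fun i _ i' _ h => (Prod.mk.inj h).1) fun c hc => ?_
    · rw [mem_filter, mem_cells_iff_colLen]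
      exact ⟨mem_Ico.1 hi, rfl⟩
    · obtain ⟨hc1, hc2⟩ := mem_filter.1 hc
      obtain ⟨i, j'⟩ := c
      simp only at hc2
      subst hc2
      exact ⟨i, mem_Ico.2 (mem_cells_iff_colLen.1 hc1), rfl⟩
  · rintro ⟨i, j⟩ hc
    rw [mem_coe, SkewShape.cells, mem_sdiff, YoungDiagram.mem_cells] at hc
    rw [mem_coe, mem_range, ← YoungDiagram.mem_iff_lt_rowLen]
    exact YoungDiagram.up_left_mem _ (Nat.zero_le _) le_rfl hc.1

/-- An empty column would contradict the overlap of consecutive rows: the row below the last inner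
row of that column still reaches it. Three boxes in one column are excluded by `row_eq_of_col_eq`.
-/
theorem colLengths_ribbon_bounds (h2 : ∀ x ∈ β.blocks, 2 ≤ x) :
    ∀ x ∈ (ribbon β).colLengths, 1 ≤ x ∧ x ≤ 2 := by
  intro x hx
  obtain ⟨j, hj, rfl⟩ := List.mem_map.1 hx
  rw [List.mem_range, ← YoungDiagram.mem_iff_lt_rowLen, YoungDiagram.mem_iff_lt_colLen] at hj
  obtain ⟨k, hk⟩ : ∃ k, (ribbon β).outer.colLen j = k + 1 :=
    ⟨(ribbon β).outer.colLen j - 1, by omega⟩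
  constructor
  · by_contra hcon
    have h3 : (k, j) ∈ (ribbon β).inner := by
      rw [YoungDiagram.mem_iff_lt_colLen]
      omega
    have h4 : (k + 1, j) ∉ (ribbon β).outer := by
      rw [YoungDiagram.mem_iff_lt_colLen]
      omega
    have h5 : k < β.blocks.length := lt_length_of_mem_outer ((ribbon β).inner_le h3)
    rw [YoungDiagram.mem_iff_lt_rowLen, rowLen_inner h5] at h3
    have h6 : k + 1 < β.blocks.length := by
      by_contra h6
      rw [ribbonStart, show k + 1 = β.blocks.length by omega, List.drop_length] at h3
      simp at h3
    rw [YoungDiagram.mem_iff_lt_rowLen, rowLen_outer h6] at h4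
    have := ribbonStart_succ h6
    omega
  · by_contra hcon
    have h3 : (k, j) ∈ (ribbon β).cells := mem_cells_iff_colLen.2 (by omega)
    have h4 : (k - 2, j) ∈ (ribbon β).cells := mem_cells_iff_colLen.2 (by omega)
    have h5 := row_eq_of_col_eq h2 (show k - 2 < k by omega) h4 h3
    omega

theorem schurInterval_ribbon (hlen : 0 < β.length) (h2 : ∀ x ∈ β.blocks, 2 ≤ x) :
    (ribbon β).schurInterval = dominanceInterval (sortedDiagram β.blocks)
      (sortedDiagram [n - β.length + 1, β.length - 1]) := by
  have hl : β.blocks.length = β.length := rfl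
  have hsize := size_eq (β := β) (List.ne_nil_of_length_pos (by omega))
  have hn : β.length ≤ n := β.length_le
  have hc : (ribbon β).colLengths.length = n - β.length + 1 := by
    rw [SkewShape.colLengths, List.length_map, List.length_range, rowLen_outer (by omega)]
    rw [List.getD_eq_getElem _ _ (by omega)] at hsize
    omega
  rw [SkewShape.schurInterval, rowLengths_ribbon,
    transpose_sortedDiagram_of_le_two (colLengths_ribbon_bounds h2) (b := β.length - 1), hc]
  rw [sum_colLengths, card_ribbon_cells, hc]
  omega

end Ribbon

end RibbonSupport

theorem mainTheorem9 {n : ℕ} (β : Composition n) (hparts : ∀ x ∈ β.blocks, 2 ≤ x)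
    (hlen : 3 ≤ β.length) (htri : AllStrictTriangles (β.blocks : Multiset ℕ)) :
    (ribbon β).HasFullSchurSupport ∧
      (ribbon β).schurSupport =
        dominanceInterval (sortedDiagram β.blocks)
          (sortedDiagram [n - β.length + 1, β.length - 1]) := by
  have hl : β.blocks.length = β.length := rfl
  -- This makes the two entries of the upper bound weakly decreasing, so sorting leaves them in
  -- place.
  have h2n : 2 * β.length ≤ n := by
    have := RibbonSupport.two_mul_card_le_sum (b := (β.blocks : Multiset ℕ)) hparts
    rwa [Multiset.coe_card, Multiset.sum_coe, β.blocks_sum] at this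
  suffices h : (ribbon β).schurSupport = dominanceInterval (sortedDiagram β.blocks)
      (sortedDiagram [n - β.length + 1, β.length - 1]) by
    refine ⟨?_, h⟩
    rw [SkewShape.HasFullSchurSupport, h, RibbonSupport.schurInterval_ribbon (by omega) hparts]
  ext nu
  rw [RibbonSupport.mem_schurSupport_ribbon (by omega) hparts, RibbonSupport.ribbonPattern,
    RibbonSupport.exists_lattice_word_iff (fun h => by
      rw [List.reverse_eq_nil_iff] at h
      rw [h] at hl
      simp at hl
      omega)
      (fun y hy => hparts y (List.mem_reverse.1 hy)) (by rwa [Multiset.coe_reverse]),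
    Multiset.coe_reverse, List.sum_reverse, List.length_reverse, β.blocks_sum]
  show _ ↔ DominatedBy _ nu ∧ DominatedBy nu _
  rw [RibbonSupport.dominatedBy_sortedDiagram_left,
    RibbonSupport.dominatedBy_sortedDiagram_pair (by omega), β.blocks_sum]
  constructor
  · rintro ⟨-, h1, h3, h4⟩
    exact ⟨⟨h1, h3⟩, by omega, by omega⟩
  · rintro ⟨⟨h1, h3⟩, -, h4⟩
    exact ⟨RibbonSupport.antitone_rowsOf nu, h1, h3, by omega⟩
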